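/- **Setting.** Let $n\ge 2$, let $\mathcal M_Z(A)=\sum_{b\in\{0,1\}^n}\langle b|A|b\rangle\,|b\rangle\langle b|$ be the dephasing channel in the computational basis of $n$ qubits, and write $\langle\langle A|\mathcal E|B\rangle\rangle=\mathrm{Tr}(A^\dagger\mathcal E(B))$, with $|b\rangle\rangle$ standing for $|b\rangle\langle b|$. Let $\mathsf{Cl}_2$ be the single-qubit Clifford group (the unitaries that normalize the Pauli group, modulo phases), let $\mathsf{Cl}_2^{\otimes n}=\{U_1\otimes\dots\otimes U_n\}$ be the local Clifford group, and let $\mathcal U(A)=UAU^\dagger$. The noise is an arbitrary gate-independent quantum channel (completely positive trace-preserving map) $\Lambda$ on $n$ qubits: every gate $\mathcal U$ is implemented as $\Lambda\,\mathcal U$. Put $$\widetilde{\mathcal M}=\mathop{\mathbb E}_{U\sim\mathsf{Cl}_2^{\otimes n}}\mathcal U^\dagger\mathcal M_Z\Lambda\,\mathcal U,\qquad \Gamma_\Lambda(z)=\frac1{2^n}\sum_{x,b\in\{0,1\}^n}(-1)^{z\cdot(x\oplus b)}\langle\langle b|\Lambda|x\rangle\rangle,\qquad F_Z(\Lambda)=\frac1{2^n}\sum_{b}\langle\langle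 b|\Lambda|b\rangle\rangle .$$ For $z\in\{0,1\}^n$ let $|z|$ be its Hamming weight, $P_z=\bigotimes_i Z^{z_i}$, and let $\Pi_z$ be the orthogonal projector (for the Hilbert–Schmidt inner product) onto the span of the Pauli operators whose non-identity tensor factors are exactly those at the positions $i$ with $z_i=1$. **Calibration with parameters $N,K\ge1$.** In each of $R=NK$ independent rounds, prepare $|0\rangle^{\otimes n}$, apply a uniformly random $U\in\mathsf{Cl}_2^{\otimes n}$ (with noise) and measure in the computational basis, so that the outcome $b$ has probability $\langle\langle b|\Lambda\,\mathcal U|\mathbf 0\rangle\rangle$; the single-round estimators are $\hat f_z^{(r)}=\langle\langle b|\mathcal U|P_z\rangle\rangle$. Let $\hat f_z$ be the median of the $K$ means of the consecutive groups of $N$ single-round estimators, and $\widehat{\mathcal M}^{-1}=\sum_z\hat f_z^{-1}\Pi_z$. The calibration is *successful* for $(k,\varepsilon)$ if $\hat f_z\neq0$ for all $|z|\le k$ and $$\bigl|\langle\langle O|\widehat{\mathcal M}^{-1}\widetilde{\mathcal M}|\rho\rangle\rangle-\mathrm{Tr}(O\rho)\bigr|\le\varepsilon\,2^k\,\|O\|_\infty$$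 simultaneously for all Hermitian $k$-local $O$ (that is, $O=\tilde O_S\otimes I_{[n]\setminus S}$ for some $S\subseteq[n]$ with $|S|=k$) and all states $\rho$. (Coefficients $\hat f_z$ with $|z|>k$ are irrelevant for $k$-local $O$; where such an $\hat f_z$ is $0$, the summand of $\widehat{\mathcal M}^{-1}$ is read as $0$.) **Theorem.** There are an absolute constant $C>0$ and positive integers $N_0=N_0(k,\varepsilon,\mu)$ and $K_0=K_0(n,k,\delta)$ with the following property. Let $n\ge2$, $0\le k\le n$, $\varepsilon>0$, $0<\delta<1$ (with $\delta\le\frac12$ if $k=0$), and let $\Lambda$ be a quantum channel on $n$ qubits. Put $\mu=\min_{|z|\le k}\Gamma_\Lambda(z)^2$. 1. If $\mu>0$, then $$R_0=N_0K_0\le C\,\frac{3^k\,(k\ln n+\ln\delta^{-1})}{\min(\varepsilon,1)^2\,\mu},$$ and for all $N\ge N_0$ and $K\ge K_0$ the calibration is successful for $(k,\varepsilon)$ with probability at least $1-\delta$. 2. If $F_Z(\Lambda)\ge1-c$ with $0\le c\le1$, then $\Gamma_\Lambda(z)\ge1-2c$ for all $z\in\{0,1\}^n$. 3. Consequently, if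 $F_Z(\Lambda)\ge1-c$ with $0\le c<\frac12$, then $\mu>0$, the conclusion of (1) holds, and $$R_0\le\frac{C}{(1-2c)^2}\cdot\frac{3^k\,(k\ln n+\ln\delta^{-1})}{\min(\varepsilon,1)^2\,F_Z(\Lambda)^2}.$$ -/

import Mathlib

open scoped Matrix

namespace RShadow

noncomputable section

open scoped ComplexOrder

/-! ### Qubits, operators, Pauli matrices -/

/-- Bit strings of length `n`; they label the computational basis of `n` qubits. -/
abbrev Bits (n : ℕ) : Type := Fin n → Fin 2

/-- Linear operators on the `n`-qubit Hilbert space, in the computational basis. -/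
abbrev Op (n : ℕ) : Type := Matrix (Bits n) (Bits n) ℂ

/-- Superoperators. -/
abbrev SuperOp (n : ℕ) : Type := Op n →ₗ[ℂ] Op n

/-- Hamming weight `|z|`. -/
def weight {n : ℕ} (z : Bits n) : ℕ := (Finset.univ.filter fun i => z i = 1).card

/-- `⟨⟨A|B⟩⟩ = Tr(A† B)`; a matrix element `⟨⟨A|ℰ|B⟩⟩` is `lbraket A (ℰ B)`. -/
def lbraket {n : ℕ} (A B : Op n) : ℂ := (Aᴴ * B).trace

/-- The computational basis state `|b⟩⟨b|`. -/
def basisState {n : ℕ} (b : Bits n) : Op n := Matrix.single b b 1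

/-- Tensor product of single-qubit matrices. -/
def tensor {n : ℕ} (A : Fin n → Matrix (Fin 2) (Fin 2) ℂ) : Op n :=
  Matrix.of fun x y => ∏ i, A i (x i) (y i)

/-- The single-qubit Pauli matrix `i^{a_x a_z} X^{a_x} Z^{a_z}`, `a = (a_x, a_z)`. -/
def pauli (a : Fin 2 × Fin 2) : Matrix (Fin 2) (Fin 2) ℂ :=
  Complex.I ^ (a.1.val * a.2.val) • (!![0, 1; 1, 0] ^ a.1.val * !![1, 0; 0, -1] ^ a.2.val)

/-- The `n`-qubit Pauli operator `P_a`. -/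
def pauliString {n : ℕ} (a : Fin n → Fin 2 × Fin 2) : Op n := tensor fun i => pauli (a i)

/-- `P_z = ⨂ᵢ Z^{zᵢ}` for a bit string `z`. -/
def pauliZ {n : ℕ} (z : Bits n) : Op n := pauliString fun i => (0, z i)

/-- The bit string that marks the tensor factors of `P_a` different from the identity. -/
def pauliSupport {n : ℕ} (a : Fin n → Fin 2 × Fin 2) : Bits n :=
  fun i => if a i = (0, 0) then 0 else 1

/-! ### The single-qubit Clifford group -/

theorem pauli_mul (a b : Fin 2 × Fin 2) :
    ∃ (m : ℕ) (c : Fin 2 × Fin 2), pauli a * pauli b = Complex.I ^ m • pauli c := by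
  refine ⟨a.1.val * a.2.val + b.1.val * b.2.val + 2 * (a.2.val * b.1.val) +
    3 * ((a.1 + b.1).val * (a.2 + b.2).val), (a.1 + b.1, a.2 + b.2), ?_⟩
  obtain ⟨a1, a2⟩ := a
  obtain ⟨b1, b2⟩ := b
  fin_cases a1 <;> fin_cases a2 <;> fin_cases b1 <;> fin_cases b2 <;>
    ext i j <;> fin_cases i <;> fin_cases j <;>
    simp [pauli, Matrix.mul_apply, Fin.sum_univ_two, pow_succ, Matrix.one_apply]

theorem pauli_mul_self (a : Fin 2 × Fin 2) : pauli a * pauli a = 1 := by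
  obtain ⟨a1, a2⟩ := a
  fin_cases a1 <;> fin_cases a2 <;> ext i j <;> fin_cases i <;> fin_cases j <;>
    simp [pauli, Matrix.mul_apply, Fin.sum_univ_two, Matrix.one_apply]

/-- The single-qubit Pauli group `⟨i⟩ ⊗ {I, X, Y, Z}`, as a subgroup of `U(2)`. -/
def pauliGroup : Subgroup (Matrix.unitaryGroup (Fin 2) ℂ) where
  carrier := {U | ∃ (m : ℕ) (a : Fin 2 × Fin 2),
    (U : Matrix (Fin 2) (Fin 2) ℂ) = Complex.I ^ m • pauli a}
  mul_mem' := by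
    rintro U V ⟨m, a, hU⟩ ⟨l, b, hV⟩
    obtain ⟨j, c, h⟩ := pauli_mul a b
    refine ⟨m + l + j, c, ?_⟩
    rw [Matrix.UnitaryGroup.mul_val, hU, hV, smul_mul_smul_comm, h, smul_smul, pow_add, pow_add]
  one_mem' := ⟨0, (0, 0), by simp [pauli]⟩
  inv_mem' := by
    rintro U ⟨m, a, hU⟩
    refine ⟨3 * m, a, ?_⟩
    have h1 : (U : Matrix (Fin 2) (Fin 2) ℂ) * (Complex.I ^ (3 * m) • pauli a) = 1 := by
      rw [hU, smul_mul_smul_comm, pauli_mul_self, ← pow_add,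
        show m + 3 * m = 4 * m by ring, pow_mul, Complex.I_pow_four, one_pow, one_smul]
    calc ((U⁻¹ : Matrix.unitaryGroup (Fin 2) ℂ) : Matrix (Fin 2) (Fin 2) ℂ)
        = (U⁻¹ : Matrix.unitaryGroup (Fin 2) ℂ).val * (U.val * (Complex.I ^ (3 * m) • pauli a)) := by
          rw [h1, mul_one]
      _ = _ := by
          rw [← mul_assoc, ← Matrix.UnitaryGroup.mul_val, inv_mul_cancel,
            Matrix.UnitaryGroup.one_val, one_mul]

/-- Unitaries that map the Pauli group to itself by conjugation. -/
abbrev cliffordUnitaries : Subgroup (Matrix.unitaryGroup (Fin 2) ℂ) :=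
  Subgroup.normalizer (pauliGroup : Set (Matrix.unitaryGroup (Fin 2) ℂ))

/-- The single-qubit Clifford group: Clifford unitaries modulo global phases (the scalar
matrices, which are the centre of `U(2)`). -/
abbrev Clifford₂ : Type :=
  cliffordUnitaries ⧸ (Subgroup.center (Matrix.unitaryGroup (Fin 2) ℂ)).subgroupOf cliffordUnitaries

instance : Finite pauliGroup := by
  refine Finite.of_injective (β := Fin 4 × (Fin 2 × Fin 2)) (fun U =>
    (⟨U.2.choose % 4, Nat.mod_lt _ (by norm_num)⟩, U.2.choose_spec.choose)) ?_
  intro U V h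
  simp only [Prod.mk.injEq, Fin.mk.injEq] at h
  refine Subtype.ext (Subtype.ext ?_)
  rw [U.2.choose_spec.choose_spec, V.2.choose_spec.choose_spec, h.2,
    Complex.I_pow_eq_pow_mod, h.1, ← Complex.I_pow_eq_pow_mod]

theorem exists_mem_pauliGroup (a : Fin 2 × Fin 2) :
    ∃ U ∈ pauliGroup, (U : Matrix (Fin 2) (Fin 2) ℂ) = pauli a := by
  have hs : star (pauli a) = pauli a := by
    obtain ⟨a1, a2⟩ := a
    fin_cases a1 <;> fin_cases a2 <;> ext i j <;> fin_cases i <;> fin_cases j <;>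
      simp [pauli, Matrix.star_apply]
  exact ⟨⟨pauli a, Matrix.mem_unitaryGroup_iff.2 (by rw [hs, pauli_mul_self])⟩,
    ⟨0, a, by simp⟩, rfl⟩

instance : Finite Clifford₂ := by
  have hle : pauliGroup.normalizerMonoidHom.ker ≤
      (Subgroup.center (Matrix.unitaryGroup (Fin 2) ℂ)).subgroupOf cliffordUnitaries := by
    rw [Subgroup.normalizerMonoidHom_ker]
    intro U hU
    have hc := Subgroup.mem_centralizer_iff.1 (Subgroup.mem_subgroupOf.1 hU)
    obtain ⟨X, hX, hX'⟩ := exists_mem_pauliGroup (1, 0)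
    obtain ⟨Z, hZ, hZ'⟩ := exists_mem_pauliGroup (0, 1)
    have h1 := congrArg Subtype.val (hc X hX)
    have h2 := congrArg Subtype.val (hc Z hZ)
    simp only [Matrix.UnitaryGroup.mul_val, hX', hZ', pauli] at h1 h2
    rw [Subgroup.mem_subgroupOf, Subgroup.mem_center_iff]
    intro V
    refine Subtype.ext ?_
    simp only [Matrix.UnitaryGroup.mul_val]
    have e1 := congrFun (congrFun h1 0) 0
    have e2 := congrFun (congrFun h1 0) 1
    have e3 := congrFun (congrFun h2 0) 1
    simp [Matrix.mul_apply, Fin.sum_univ_two] at e1 e2 e3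
    have e4 := self_eq_neg.1 e3
    ext i j
    fin_cases i <;> fin_cases j <;>
      simp [Matrix.mul_apply, Fin.sum_univ_two, e1, e2, e4, mul_comm]
  have := Subgroup.finiteIndex_ker pauliGroup.normalizerMonoidHom
  have := Subgroup.finiteIndex_of_le hle
  exact Subgroup.finite_quotient_of_finiteIndex

instance : Fintype Clifford₂ := Fintype.ofFinite _

/-- The local Clifford group, the `n`-fold product of the single-qubit Clifford group. -/
abbrev LocalClifford (n : ℕ) : Type := Fin n → Clifford₂

/-- A unitary `U₁ ⊗ ⋯ ⊗ Uₙ` representing an element of the local Clifford group. It is determined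
up to a phase, which has no influence on the conjugations below. -/
def LocalClifford.unitary {n : ℕ} (g : LocalClifford n) : Op n :=
  tensor fun i => ((g i).out : Matrix.unitaryGroup (Fin 2) ℂ).val

/-- `A ↦ V A V†`. -/
def conjBy {n : ℕ} (V : Op n) : SuperOp n where
  toFun A := V * A * Vᴴ
  map_add' A B := by rw [mul_add, add_mul]
  map_smul' c A := by simp

/-- The unitary channel `𝒰` of a local Clifford element. -/
def LocalClifford.channel {n : ℕ} (g : LocalClifford n) : SuperOp n := conjBy g.unitary

/-- The adjoint channel `𝒰†`, i.e. `A ↦ U† A U`. -/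
def LocalClifford.channelAdj {n : ℕ} (g : LocalClifford n) : SuperOp n := conjBy g.unitaryᴴ

/-! ### Channels, states, observables -/

/-- The extension `id_m ⊗ ℰ` of a superoperator. -/
def ampliation {n : ℕ} (m : ℕ) (E : SuperOp n)
    (A : Matrix (Fin m × Bits n) (Fin m × Bits n) ℂ) :
    Matrix (Fin m × Bits n) (Fin m × Bits n) ℂ :=
  Matrix.of fun p q => E (Matrix.of fun x y => A (p.1, x) (q.1, y)) p.2 q.2

/-- Quantum channels: completely positive and trace preserving. -/
structure IsQuantumChannel {n : ℕ} (E : SuperOp n) : Prop where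
  completelyPositive : ∀ (m : ℕ) (A : Matrix (Fin m × Bits n) (Fin m × Bits n) ℂ),
    A.PosSemidef → (ampliation m E A).PosSemidef
  tracePreserving : ∀ A : Op n, (E A).trace = A.trace

/-- Quantum states. -/
structure IsState {n : ℕ} (ρ : Op n) : Prop where
  posSemidef : ρ.PosSemidef
  trace_eq_one : ρ.trace = 1

/-- `O = Õ_S ⊗ I` for some set `S` of `k` qubits. -/
def IsLocal {n : ℕ} (k : ℕ) (O : Op n) : Prop :=
  ∃ S : Finset (Fin n), S.card = k ∧ ∃ T : Matrix (S → Fin 2) (S → Fin 2) ℂ,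
    ∀ x y : Bits n,
      O x y = if ∀ i, i ∉ S → x i = y i then T (fun i => x i) (fun i => y i) else 0

/-- The spectral norm `‖O‖_∞`. -/
def opNorm {n : ℕ} (O : Op n) : ℝ := ‖Matrix.toEuclideanCLM (𝕜 := ℂ) O‖

/-! ### The measurement channel and the noise parameters -/

/-- The dephasing channel `M_Z = ∑_b |b⟩⟩⟨⟨b|`. -/
def dephasing (n : ℕ) : SuperOp n where
  toFun A := ∑ b, lbraket (basisState b) A • basisState b
  map_add' A B := by simp [lbraket, mul_add, add_smul, Finset.sum_add_distrib]
  map_smul' c A := by simp [lbraket, mul_smul, Finset.smul_sum]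

/-- The noisy measurement channel `M̃`, the average of `𝒰† M_Z Λ 𝒰` over the local Clifford
group. -/
def noisyTwirl {n : ℕ} (Λ : SuperOp n) : SuperOp n :=
  ((Fintype.card (LocalClifford n) : ℂ)⁻¹) •
    ∑ g : LocalClifford n, g.channelAdj ∘ₗ dephasing n ∘ₗ Λ ∘ₗ g.channel

/-- `Π_z`, the orthogonal projector onto the span of the Pauli operators with support `z`; it is
the sum of `|σ_a⟩⟩⟨⟨σ_a|` with `σ_a = P_a / √(2^n)` over these Pauli operators. -/
def proj {n : ℕ} (z : Bits n) : SuperOp n where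
  toFun A := ∑ a : Fin n → Fin 2 × Fin 2,
    if pauliSupport a = z then ((2 : ℂ) ^ n)⁻¹ • lbraket (pauliString a) A • pauliString a else 0
  map_add' A B := by
    rw [← Finset.sum_add_distrib]
    refine Finset.sum_congr rfl fun a _ => ?_
    split_ifs <;> simp [lbraket, mul_add, add_smul]
  map_smul' c A := by
    rw [Finset.smul_sum]
    refine Finset.sum_congr rfl fun a _ => ?_
    split_ifs
    · simp only [lbraket, Matrix.mul_smul, Matrix.trace_smul, smul_eq_mul, smul_smul,
        RingHom.id_apply]
      congr 1
      ring
    · simp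

/-- `Γ_Λ(z) = 2^{-n} ∑_{x,b} (-1)^{z·(x⊕b)} ⟨⟨b|Λ|x⟩⟩`. Addition in `Fin 2` is exclusive or. -/
def Gam {n : ℕ} (Λ : SuperOp n) (z : Bits n) : ℝ :=
  ((2 : ℝ) ^ n)⁻¹ * ∑ x : Bits n, ∑ b : Bits n,
    (-1 : ℝ) ^ (∑ i, (z i).val * (x i + b i).val) *
      (lbraket (basisState b) (Λ (basisState x))).re

/-- `min_{|z| ≤ k} Γ_Λ(z)²`. -/
def minGamSq {n : ℕ} (Λ : SuperOp n) (k : ℕ) : ℝ :=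
  (Finset.univ.filter fun z : Bits n => weight z ≤ k).inf' ⟨0, Finset.mem_filter.2 ⟨Finset.mem_univ _, by simp [weight]⟩⟩
    fun z => Gam Λ z ^ 2

/-- The `Z`-basis average fidelity. -/
def fidelityZ {n : ℕ} (Λ : SuperOp n) : ℝ :=
  ((2 : ℝ) ^ n)⁻¹ * ∑ b : Bits n, (lbraket (basisState b) (Λ (basisState b))).re

/-! ### The calibration procedure -/

/-- The data of one calibration round: the sampled gate and the measured bit string. -/
abbrev Round (n : ℕ) : Type := LocalClifford n × Bits n

instance : MeasurableSpace Clifford₂ := ⊤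

instance : DiscreteMeasurableSpace Clifford₂ := ⟨fun _ => trivial⟩

/-- The probability of a round: the gate is uniform, and given the gate the outcome `b` has
probability `⟨⟨b|Λ𝒰|0⟩⟩`. -/
def roundProb {n : ℕ} (Λ : SuperOp n) (o : Round n) : ℝ :=
  (Fintype.card (LocalClifford n) : ℝ)⁻¹ *
    (lbraket (basisState o.2) (Λ (o.1.channel (basisState 0)))).re

/-- The law of one calibration round. -/
def roundLaw {n : ℕ} (Λ : SuperOp n) : MeasureTheory.Measure (Round n) :=
  ∑ o : Round n, ENNReal.ofReal (roundProb Λ o) • MeasureTheory.Measure.dirac o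

/-- The record of `R = N K` calibration rounds, arranged in `K` groups of `N` rounds. -/
abbrev Record (n N K : ℕ) : Type := Fin K × Fin N → Round n

/-- The joint law of `N K` independent calibration rounds. -/
def calibrationLaw {n : ℕ} (Λ : SuperOp n) (N K : ℕ) : MeasureTheory.Measure (Record n N K) :=
  MeasureTheory.Measure.pi fun _ => roundLaw Λ

/-- The single-round estimator `⟨⟨b|𝒰|P_z⟩⟩` (a real number). -/
def noiseEst {n : ℕ} (z : Bits n) (o : Round n) : ℝ :=
  (lbraket (basisState o.2) (o.1.channel (pauliZ z))).re

/-- The median of `K` real numbers: the middle entry in increasing order, or the mean of the two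
middle entries if `K` is even (`0` for `K = 0`). -/
def median {K : ℕ} (v : Fin K → ℝ) : ℝ :=
  if h : 0 < K then
    (v (Tuple.sort v ⟨(K - 1) / 2, by omega⟩) + v (Tuple.sort v ⟨K / 2, by omega⟩)) / 2
  else 0

/-- The median-of-means estimator `f̂_z`. -/
def fHat {n N K : ℕ} (ω : Record n N K) (z : Bits n) : ℝ :=
  median fun t : Fin K => (N : ℝ)⁻¹ * ∑ s : Fin N, noiseEst z (ω (t, s))

/-- The inverse `M̂⁻¹ = ∑_z f̂_z⁻¹ Π_z` of `M̂ = ∑_z f̂_z Π_z`. -/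
def invEstimate {n N K : ℕ} (ω : Record n N K) : SuperOp n :=
  ∑ z : Bits n, (((fHat ω z)⁻¹ : ℝ) : ℂ) • proj z

/-- The records for which the calibration is successful with precision `ε` for `k`-local
observables: the coefficients `f̂_z`, `|z| ≤ k`, can be inverted (no others are relevant for
`k`-local observables), and the error bound holds for all observables and states. -/
def successEvent {n : ℕ} (Λ : SuperOp n) (k : ℕ) (ε : ℝ) (N K : ℕ) : Set (Record n N K) :=
  {ω | (∀ z : Bits n, weight z ≤ k → fHat ω z ≠ 0) ∧
    ∀ O : Op n, O.IsHermitian → IsLocal k O → ∀ ρ : Op n, IsState ρ →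
      ‖lbraket O (invEstimate ω (noisyTwirl Λ ρ)) - (O * ρ).trace‖ ≤ ε * 2 ^ k * opNorm O}

/-- `N₀ K₀` calibration rounds (or more) suffice to succeed with probability at least `1 - δ`. -/
def CalibrationSuffices {n : ℕ} (Λ : SuperOp n) (k : ℕ) (ε δ : ℝ) (N₀ K₀ : ℕ) : Prop :=
  0 < N₀ ∧ 0 < K₀ ∧ ∀ N K : ℕ, N₀ ≤ N → K₀ ≤ K →
    ENNReal.ofReal (1 - δ) ≤ calibrationLaw Λ N K (successEvent Λ k ε N K)

end

end RShadow

namespace RShadow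

noncomputable section

open scoped ComplexOrder

/-! ### Averages over the single-qubit Clifford group -/

/-! The second moment of the local Clifford group makes `noisyTwirl Λ` diagonal in the Pauli basis:
a Pauli with support `z` has eigenvalue `f_z = 3^{-|z|} Γ_Λ(z)` (`noisyTwirl_pauliString`). The same
moment shows that the single-round estimator has mean `f_z` and second moment exactly `3^{-|z|}`,
whatever the noise (`sum_roundProb_mul_noiseEst`, `sum_roundProb_mul_noiseEst_sq`).

Chebyshev's inequality for the group means, an exponential-moment bound for the median and a union
bound over at most `(n+1)^k` strings give every `f_z` with `|z| ≤ k` up to relative error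
`min(ε,1)/2` (`sum_mean_deviation_le`, `sum_majority_le`, `card_weight_le`). Relative error is what
matters: the error of the inverse is the Pauli expansion of `Tr(Oρ)` weighted by `f_z / f̂_z - 1`. A
`k`-local `O` has at most `4^k` nonzero Pauli coefficients, so Cauchy–Schwarz and Parseval yield the
factor `2^k ‖O‖` (`norm_error_le`).

The fidelity bound holds because the diagonal transitions enter `Γ_Λ(z)` with sign `+1`, while the
remaining ones, of average total mass `1 - F_Z`, contribute at least minus that mass. -/

theorem pauli_conjTranspose (a : Fin 2 × Fin 2) : (pauli a)ᴴ = pauli a := by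
  obtain ⟨a1, a2⟩ := a
  fin_cases a1 <;> fin_cases a2 <;> ext i j <;> fin_cases i <;> fin_cases j <;>
    simp [pauli, Matrix.conjTranspose_apply]

theorem pauli_zero : pauli (0, 0) = 1 := by simp [pauli]

theorem trace_pauli {a : Fin 2 × Fin 2} (ha : a ≠ (0, 0)) : (pauli a).trace = 0 := by
  obtain ⟨a1, a2⟩ := a
  fin_cases a1 <;> fin_cases a2 <;> simp_all [pauli, Matrix.trace_fin_two]

/-- In tensor form, the sum of `P_a ⊗ P_a` is twice the swap. Both the Pauli expansion and the sum
rule for Clifford moments rest on this. -/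
theorem pauli_completeness (u v x y : Fin 2) :
    ∑ a, pauli a u v * pauli a x y = if u = y ∧ v = x then 2 else 0 := by
  rw [Fintype.sum_prod_type, Fin.sum_univ_two, Fin.sum_univ_two, Fin.sum_univ_two]
  fin_cases u <;> fin_cases v <;> fin_cases x <;> fin_cases y <;>
    simp [pauli] <;> norm_num

theorem trace_pauli_mul_pauli (a b : Fin 2 × Fin 2) :
    (pauli a * pauli b).trace = if a = b then 2 else 0 := by
  obtain ⟨a1, a2⟩ := a
  obtain ⟨b1, b2⟩ := b
  fin_cases a1 <;> fin_cases a2 <;> fin_cases b1 <;> fin_cases b2 <;>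
    simp [pauli, Matrix.trace_fin_two] <;> norm_num

/-- Two distinct Pauli matrices are distinguished by the signs under conjugation with a third. -/
theorem exists_pauli_conj_sign {a c : Fin 2 × Fin 2} (h : c ≠ a) :
    ∃ (d : Fin 2 × Fin 2) (s : ℂ), pauli d * pauli a * pauli d = s • pauli a ∧
      pauli d * pauli c * pauli d = (-s) • pauli c := by
  -- The sign is the symplectic form of the labels. Conjugation by `X` detects the second component
  -- of a label and conjugation by `Z` the first, which dictates the witnesses below.
  have key : ∀ d e : Fin 2 × Fin 2, pauli d * pauli e * pauli d =
      (-1 : ℂ) ^ (d.1.val * e.2.val + d.2.val * e.1.val) • pauli e := by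
    rintro ⟨d1, d2⟩ ⟨e1, e2⟩
    fin_cases d1 <;> fin_cases d2 <;> fin_cases e1 <;> fin_cases e2 <;>
      ext i j <;> fin_cases i <;> fin_cases j <;>
      simp [pauli, Matrix.mul_apply, Fin.sum_univ_two, Matrix.one_apply]
  simp only [key]
  obtain ⟨a1, a2⟩ := a
  obtain ⟨c1, c2⟩ := c
  by_cases h1 : c1 = a1
  · refine ⟨(1, 0), _, rfl, ?_⟩
    fin_cases a2 <;> fin_cases c2 <;> simp_all
  · refine ⟨(0, 1), _, rfl, ?_⟩
    fin_cases a1 <;> fin_cases c1 <;> simp_all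

/-- The rotation by `2π/3` about the axis `(1,1,1)`, which permutes `X → Y → Z → X`. -/
def cyclicMatrix : Matrix (Fin 2) (Fin 2) ℂ :=
  !![(1 - Complex.I) / 2, (-1 - Complex.I) / 2; (1 - Complex.I) / 2, (1 + Complex.I) / 2]

/-- The permutation of the labels of Pauli matrices induced by `cyclicMatrix`. -/
def cyclicPerm (a : Fin 2 × Fin 2) : Fin 2 × Fin 2 := (a.1 + a.2, a.1)

theorem cyclicMatrix_conjTranspose : cyclicMatrixᴴ =
    !![(1 + Complex.I) / 2, (1 + Complex.I) / 2; (-1 + Complex.I) / 2, (1 - Complex.I) / 2] := by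
  ext i j
  fin_cases i <;> fin_cases j <;> apply Complex.ext <;>
    simp [cyclicMatrix, Matrix.conjTranspose_apply]

theorem cyclicMatrix_mul_conjTranspose : cyclicMatrix * cyclicMatrixᴴ = 1 := by
  have hI := Complex.I_mul_I
  rw [cyclicMatrix_conjTranspose]
  ext i j
  fin_cases i <;> fin_cases j <;>
    simp [cyclicMatrix, Matrix.mul_apply, Fin.sum_univ_two] <;> ring_nf <;>
    simp [Complex.I_sq] <;> norm_num

theorem cyclicMatrix_conj_pauli (a : Fin 2 × Fin 2) :
    cyclicMatrix * pauli a * cyclicMatrixᴴ = pauli (cyclicPerm a) := by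
  rw [cyclicMatrix_conjTranspose]
  obtain ⟨a1, a2⟩ := a
  fin_cases a1 <;> fin_cases a2 <;> ext i j <;> fin_cases i <;> fin_cases j <;>
    simp [cyclicMatrix, cyclicPerm, pauli, Matrix.mul_apply, Fin.sum_univ_two] <;> ring_nf <;>
    simp [Complex.I_sq] <;> ring_nf

theorem cyclicMatrix_mem_unitaryGroup : cyclicMatrix ∈ Matrix.unitaryGroup (Fin 2) ℂ :=
  Matrix.mem_unitaryGroup_iff.2 cyclicMatrix_mul_conjTranspose

/-- `cyclicMatrix` as a unitary. -/
def cyclicUnitary : Matrix.unitaryGroup (Fin 2) ℂ := ⟨cyclicMatrix, cyclicMatrix_mem_unitaryGroup⟩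

theorem cyclicUnitary_mem : cyclicUnitary ∈ cliffordUnitaries := by
  have hfwd : ∀ h ∈ pauliGroup, cyclicUnitary * h * cyclicUnitary⁻¹ ∈ pauliGroup := by
    rintro h ⟨m, a, ha⟩
    refine ⟨m, cyclicPerm a, ?_⟩
    rw [← cyclicMatrix_conj_pauli, Matrix.UnitaryGroup.mul_val, Matrix.UnitaryGroup.mul_val,
      ha, Matrix.mul_smul, Matrix.smul_mul]
    rfl
  rw [Subgroup.mem_normalizer_iff_map_conj_eq]
  -- The Pauli group is finite, so inclusion of its conjugate already gives equality; the inverse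
  -- conjugation need not be computed.
  refine Subgroup.eq_of_le_of_card_ge ?_ ?_
  · rintro _ ⟨h, hh, rfl⟩
    exact hfwd h hh
  · rw [Subgroup.card_map_of_injective (MulEquiv.injective _)]

theorem pauliGroup_le_cliffordUnitaries : pauliGroup ≤ cliffordUnitaries := Subgroup.le_normalizer

/-- The image `g P_a g†` of a Pauli matrix under a Clifford element. -/
def cliffordConj (g : Clifford₂) (a : Fin 2 × Fin 2) : Matrix (Fin 2) (Fin 2) ℂ :=
  (g.out : Matrix.unitaryGroup (Fin 2) ℂ).val * pauli a *
    ((g.out : Matrix.unitaryGroup (Fin 2) ℂ).val)ᴴ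

/-- The representative chosen by `out` differs from `U` by a central unitary, which commutes with
every Pauli and cancels in the conjugation. -/
theorem cliffordConj_mk (U : cliffordUnitaries) (a : Fin 2 × Fin 2) :
    cliffordConj (QuotientGroup.mk U) a = U.1.val * pauli a * (U.1.val)ᴴ := by
  obtain ⟨c, hc⟩ := QuotientGroup.mk_out_eq_mul
    ((Subgroup.center (Matrix.unitaryGroup (Fin 2) ℂ)).subgroupOf cliffordUnitaries) U
  obtain ⟨P, -, hP⟩ := exists_mem_pauliGroup a
  have hcc := Subgroup.mem_center_iff.1 (Subgroup.mem_subgroupOf.1 c.2) P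
  have hcc' := congrArg Subtype.val hcc
  simp only [Matrix.UnitaryGroup.mul_val, hP] at hcc'
  have hu : (c.1.1.val) * (c.1.1.val)ᴴ = 1 := Matrix.mem_unitaryGroup_iff.1 c.1.1.2
  rw [cliffordConj, hc]
  simp only [Subgroup.coe_mul, Matrix.UnitaryGroup.mul_val, Matrix.conjTranspose_mul]
  calc U.1.val * c.1.1.val * pauli a * ((c.1.1.val)ᴴ * (U.1.val)ᴴ)
      = U.1.val * (c.1.1.val * pauli a) * ((c.1.1.val)ᴴ * (U.1.val)ᴴ) := by
        simp only [mul_assoc]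
    _ = U.1.val * pauli a * (c.1.1.val * (c.1.1.val)ᴴ) * (U.1.val)ᴴ := by
        rw [← hcc']; simp only [mul_assoc]
    _ = _ := by rw [hu, mul_one]

theorem cliffordConj_mul_mk (g : Clifford₂) (U : cliffordUnitaries) (a : Fin 2 × Fin 2) :
    cliffordConj (g * QuotientGroup.mk U) a =
      (g.out : Matrix.unitaryGroup (Fin 2) ℂ).val * (U.1.val * pauli a * (U.1.val)ᴴ) *
        ((g.out : Matrix.unitaryGroup (Fin 2) ℂ).val)ᴴ := by
  conv_lhs => rw [← QuotientGroup.out_eq' g, ← QuotientGroup.mk_mul, cliffordConj_mk]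
  simp only [Subgroup.coe_mul, Matrix.UnitaryGroup.mul_val, Matrix.conjTranspose_mul, mul_assoc]

theorem out_mul_conjTranspose (g : Clifford₂) :
    (g.out : Matrix.unitaryGroup (Fin 2) ℂ).val *
      ((g.out : Matrix.unitaryGroup (Fin 2) ℂ).val)ᴴ = 1 :=
  Matrix.mem_unitaryGroup_iff.1 g.out.1.2

theorem conjTranspose_mul_out (g : Clifford₂) :
    ((g.out : Matrix.unitaryGroup (Fin 2) ℂ).val)ᴴ *
      (g.out : Matrix.unitaryGroup (Fin 2) ℂ).val = 1 :=
  Matrix.mem_unitaryGroup_iff'.1 g.out.1.2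

theorem cliffordConj_zero (g : Clifford₂) : cliffordConj g (0, 0) = 1 := by
  rw [cliffordConj, pauli_zero, mul_one, out_mul_conjTranspose]

theorem cliffordConj_conjTranspose (g : Clifford₂) (a : Fin 2 × Fin 2) :
    (cliffordConj g a)ᴴ = cliffordConj g a := by
  simp [cliffordConj, pauli_conjTranspose, mul_assoc]

theorem trace_cliffordConj (g : Clifford₂) {a : Fin 2 × Fin 2} (ha : a ≠ (0, 0)) :
    (cliffordConj g a).trace = 0 := by
  rw [cliffordConj, Matrix.trace_mul_comm, ← mul_assoc, conjTranspose_mul_out, one_mul,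
    trace_pauli ha]

/-- The swap commutes with `V ⊗ V`, so the conjugated Paulis obey the same completeness relation;
this is its `(b, b)` entry in the first factor. No average over the group is involved. -/
theorem sum_apply_smul_cliffordConj (g : Clifford₂) (b : Fin 2) :
    ∑ a, cliffordConj g a b b • cliffordConj g a = (2 : ℂ) • Matrix.single b b 1 := by
  set V := (g.out : Matrix.unitaryGroup (Fin 2) ℂ).val with hV
  have hVV : V * Vᴴ = 1 := out_mul_conjTranspose g
  ext x y
  have hx := congrFun (congrFun hVV x) b
  have hy := congrFun (congrFun hVV b) y
  rw [Matrix.mul_apply, Fin.sum_univ_two] at hx hy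
  have e : ∀ a, cliffordConj g a b b * cliffordConj g a x y =
      ∑ p, ∑ q, ∑ r, ∑ s, V b p * Vᴴ q b * V x r * Vᴴ s y * (pauli a p q * pauli a r s) := by
    intro a
    simp only [cliffordConj, ← hV, Matrix.mul_apply, Fin.sum_univ_two]
    ring
  rw [Matrix.sum_apply]
  simp only [Matrix.smul_apply, smul_eq_mul, e]
  have e2 : ∑ a, ∑ p, ∑ q, ∑ r, ∑ s, V b p * Vᴴ q b * V x r * Vᴴ s y *
        (pauli a p q * pauli a r s) =
      ∑ p, ∑ q, ∑ r, ∑ s, V b p * Vᴴ q b * V x r * Vᴴ s y *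
        ∑ a, (pauli a p q * pauli a r s) := by
    simp only [Finset.mul_sum]
    rw [Finset.sum_comm]; refine Finset.sum_congr rfl fun p _ => ?_
    rw [Finset.sum_comm]; refine Finset.sum_congr rfl fun q _ => ?_
    rw [Finset.sum_comm]; refine Finset.sum_congr rfl fun r _ => ?_
    rw [Finset.sum_comm]
  rw [e2]
  simp only [pauli_completeness, Fin.sum_univ_two]
  simp only [Matrix.single_apply, Matrix.one_apply] at hx hy ⊢
  rw [show (2 : ℂ) * (if b = x ∧ b = y then 1 else 0) =
    2 * ((if x = b then 1 else 0) * (if b = y then 1 else 0)) by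
      by_cases h : b = x <;> by_cases h' : b = y <;> simp [h, h', eq_comm], ← hx, ← hy]
  simp
  ring

/-- The second-moment sum of the Clifford group. -/
def cliffordMoment (b : Fin 2) (c a : Fin 2 × Fin 2) : Matrix (Fin 2) (Fin 2) ℂ :=
  ∑ g : Clifford₂, cliffordConj g c b b • cliffordConj g a

theorem cliffordMoment_right_mul (b : Fin 2) (c a : Fin 2 × Fin 2) (h : Clifford₂) :
    cliffordMoment b c a =
      ∑ g : Clifford₂, cliffordConj (g * h) c b b • cliffordConj (g * h) a :=
  (Equiv.sum_comp (Equiv.mulRight h)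
    fun g => cliffordConj g c b b • cliffordConj g a).symm

/-- Reindexing the sum by right multiplication with a Pauli that distinguishes `a` from `c`
multiplies each term by `s * (-s) = -1`. -/
theorem cliffordMoment_of_ne (b : Fin 2) {c a : Fin 2 × Fin 2} (h : c ≠ a) :
    cliffordMoment b c a = 0 := by
  obtain ⟨d, s, ha, hc⟩ := exists_pauli_conj_sign h
  obtain ⟨D, hD, hD'⟩ := exists_mem_pauliGroup d
  have hs : s * s = 1 := by
    have h1 : pauli d * (pauli d * pauli a * pauli d) * pauli d = pauli a := by
      calc _ = (pauli d * pauli d) * pauli a * (pauli d * pauli d) := by simp only [mul_assoc]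
        _ = _ := by rw [pauli_mul_self, one_mul, mul_one]
    rw [ha, Matrix.mul_smul, Matrix.smul_mul, ha, smul_smul] at h1
    have h2 := congrArg (fun M => (M * pauli a).trace) h1
    simp [trace_pauli_mul_pauli] at h2
    exact h2
  have hconj : ∀ e t, pauli d * pauli e * pauli d = t • pauli e → ∀ g : Clifford₂,
      cliffordConj (g * QuotientGroup.mk ⟨D, pauliGroup_le_cliffordUnitaries hD⟩) e =
        (t : ℂ) • cliffordConj g e := by
    intro e t ht g
    rw [cliffordConj_mul_mk]
    simp only [hD', pauli_conjTranspose, ht, Matrix.mul_smul, Matrix.smul_mul]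
    rfl
  have h1 := cliffordMoment_right_mul b c a
    (QuotientGroup.mk ⟨D, pauliGroup_le_cliffordUnitaries hD⟩)
  simp only [hconj a s ha, hconj c (-s) hc, Matrix.smul_apply, smul_smul, smul_eq_mul] at h1
  have h2 : cliffordMoment b c a = - cliffordMoment b c a := by
    conv_lhs => rw [h1]
    rw [cliffordMoment, ← Finset.sum_neg_distrib]
    refine Finset.sum_congr rfl fun g _ => ?_
    rw [← neg_smul]
    congr 1
    linear_combination (-(cliffordConj g c b b)) * hs
  ext i j
  exact self_eq_neg.1 (congrFun (congrFun h2 i) j)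

/-- Pauli reindexing cannot relate the diagonal moments; reindexing by the cyclic rotation makes
those of `X`, `Y` and `Z` equal. -/
theorem cliffordMoment_cyclicPerm (b : Fin 2) (a : Fin 2 × Fin 2) :
    cliffordMoment b (cyclicPerm a) (cyclicPerm a) = cliffordMoment b a a := by
  have h1 := cliffordMoment_right_mul b a a (QuotientGroup.mk ⟨cyclicUnitary, cyclicUnitary_mem⟩)
  have h2 : ∀ g : Clifford₂,
      cliffordConj (g * QuotientGroup.mk ⟨cyclicUnitary, cyclicUnitary_mem⟩) a =
        cliffordConj g (cyclicPerm a) := by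
    intro g
    rw [cliffordConj_mul_mk, cliffordConj, ← cyclicMatrix_conj_pauli]
    rfl
  simp only [h2] at h1
  exact h1.symm

theorem cliffordMoment_zero (b : Fin 2) :
    cliffordMoment b (0, 0) (0, 0) = (Fintype.card Clifford₂ : ℂ) • 1 := by
  simp [cliffordMoment, cliffordConj_zero, Nat.cast_smul_eq_nsmul]

/-- The label of the diagonal Pauli matrix with the same support. -/
def suppBit (a : Fin 2 × Fin 2) : Fin 2 := if a = (0, 0) then 0 else 1

/-- The four diagonal moments add up to `|G| · 2|b⟩⟨b|`. Removing the identity's share `|G| · 1`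
leaves `|G| (-1)^b Z`, divided equally among three moments; hence the factor `1/3` per non-identity
position. -/
theorem cliffordMoment_self (b : Fin 2) (a : Fin 2 × Fin 2) :
    cliffordMoment b a a = ((Fintype.card Clifford₂ : ℂ) * (3⁻¹) ^ (suppBit a).val *
      (-1) ^ ((suppBit a).val * b.val)) • pauli (0, suppBit a) := by
  have hsum : ∑ a, cliffordMoment b a a =
      (Fintype.card Clifford₂ : ℂ) • (2 : ℂ) • Matrix.single b b 1 := by
    simp only [cliffordMoment]
    rw [Finset.sum_comm]
    simp only [sum_apply_smul_cliffordConj]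
    simp [Nat.cast_smul_eq_nsmul]
  have hX := cliffordMoment_cyclicPerm b (1, 0)
  have hY := cliffordMoment_cyclicPerm b (1, 1)
  have e1 : cyclicPerm (1, 0) = (1, 1) := by decide
  have e2 : cyclicPerm (1, 1) = (0, 1) := by decide
  rw [e1] at hX
  rw [e2] at hY
  rw [Fintype.sum_prod_type, Fin.sum_univ_two, Fin.sum_univ_two, Fin.sum_univ_two,
    cliffordMoment_zero, hY, hX] at hsum
  have hX' : cliffordMoment b (1, 0) (1, 0) = ((Fintype.card Clifford₂ : ℂ) * 3⁻¹ *
      (-1) ^ b.val) • pauli (0, 1) := by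
    ext i j
    have h := congrFun (congrFun hsum i) j
    simp only [Matrix.add_apply, Matrix.smul_apply, smul_eq_mul] at h ⊢
    rw [show cliffordMoment b (1, 0) (1, 0) i j = (3⁻¹ : ℂ) *
      ((Fintype.card Clifford₂ : ℂ) * (2 * Matrix.single b b 1 i j) -
        (Fintype.card Clifford₂ : ℂ) * (1 : Matrix (Fin 2) (Fin 2) ℂ) i j) by
      rw [← h]; ring]
    fin_cases b <;> fin_cases i <;> fin_cases j <;>
      simp [pauli] <;> ring
  obtain ⟨a1, a2⟩ := a
  fin_cases a1 <;> fin_cases a2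
  · simp [suppBit, cliffordMoment_zero, pauli_zero]
  · simpa [suppBit, hY, hX] using hX'
  · simpa [suppBit] using hX'
  · simpa [suppBit, hX] using hX'

/-! ### Tensor products and Pauli strings -/

theorem prod_ite_one_zero {ι R : Type*} [Fintype ι] [CommSemiring R] (p : ι → Prop)
    [DecidablePred p] [Decidable (∀ i, p i)] (c : R) :
    (∏ i, if p i then c else 0) = if ∀ i, p i then c ^ Fintype.card ι else 0 := by
  split_ifs with h
  · simp [h]
  · push Not at h
    obtain ⟨i, hi⟩ := h
    exact Finset.prod_eq_zero (Finset.mem_univ i) (by simp [hi])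

theorem tensor_apply {n : ℕ} (A : Fin n → Matrix (Fin 2) (Fin 2) ℂ) (x y : Bits n) :
    tensor A x y = ∏ i, A i (x i) (y i) := rfl

theorem tensor_mul {n : ℕ} (A B : Fin n → Matrix (Fin 2) (Fin 2) ℂ) :
    tensor A * tensor B = tensor fun i => A i * B i := by
  ext x y
  simp only [Matrix.mul_apply, tensor_apply, Fintype.prod_sum, Finset.prod_mul_distrib]

theorem tensor_conjTranspose {n : ℕ} (A : Fin n → Matrix (Fin 2) (Fin 2) ℂ) :
    (tensor A)ᴴ = tensor fun i => (A i)ᴴ := by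
  ext x y
  simp [tensor_apply, Matrix.conjTranspose_apply]

theorem trace_tensor {n : ℕ} (A : Fin n → Matrix (Fin 2) (Fin 2) ℂ) :
    (tensor A).trace = ∏ i, (A i).trace := by
  simp only [Matrix.trace, Matrix.diag_apply, tensor_apply, Fintype.prod_sum]

theorem tensor_one {n : ℕ} : tensor (fun _ : Fin n => (1 : Matrix (Fin 2) (Fin 2) ℂ)) = 1 := by
  ext x y
  simp only [tensor_apply, Matrix.one_apply, prod_ite_one_zero, one_pow, funext_iff]

theorem tensor_smul {n : ℕ} (c : Fin n → ℂ) (A : Fin n → Matrix (Fin 2) (Fin 2) ℂ) :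
    (tensor fun i => c i • A i) = (∏ i, c i) • tensor A := by
  ext x y
  simp [tensor_apply, Finset.prod_mul_distrib]

theorem sum_tensor {n : ℕ} {ι : Type*} [Fintype ι]
    (F : Fin n → ι → Matrix (Fin 2) (Fin 2) ℂ) :
    ∑ g : Fin n → ι, (tensor fun i => F i (g i)) = tensor fun i => ∑ t, F i t := by
  ext x y
  simp only [Matrix.sum_apply, tensor_apply, Fintype.prod_sum]

theorem pauliString_conjTranspose {n : ℕ} (a : Fin n → Fin 2 × Fin 2) :
    (pauliString a)ᴴ = pauliString a := by
  simp only [pauliString, tensor_conjTranspose, pauli_conjTranspose]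

theorem pauliString_mul_self {n : ℕ} (a : Fin n → Fin 2 × Fin 2) :
    pauliString a * pauliString a = 1 := by
  simp only [pauliString, tensor_mul, pauli_mul_self, tensor_one]

theorem trace_pauliString_mul_pauliString {n : ℕ} (a b : Fin n → Fin 2 × Fin 2) :
    (pauliString a * pauliString b).trace = if a = b then 2 ^ n else 0 := by
  simp only [pauliString, tensor_mul, trace_tensor, trace_pauli_mul_pauli]
  rw [prod_ite_one_zero, Fintype.card_fin]
  simp only [funext_iff]

theorem pauliString_completeness {n : ℕ} (u v x y : Bits n) :
    ∑ a : Fin n → Fin 2 × Fin 2, pauliString a u v * pauliString a x y =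
      if u = y ∧ v = x then 2 ^ n else 0 := by
  simp only [pauliString, tensor_apply, ← Finset.prod_mul_distrib]
  rw [← Fintype.prod_sum fun i (t : Fin 2 × Fin 2) => pauli t (u i) (v i) * pauli t (x i) (y i)]
  simp only [pauli_completeness]
  rw [prod_ite_one_zero, Fintype.card_fin]
  simp only [funext_iff, forall_and]

theorem trace_mul_eq_sum {m : Type*} [Fintype m] (A B : Matrix m m ℂ) :
    (A * B).trace = ∑ x, ∑ y, A x y * B y x := by
  simp [Matrix.trace, Matrix.mul_apply]

theorem sum_trace_pauliString_smul {n : ℕ} (A : Op n) :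
    ∑ a : Fin n → Fin 2 × Fin 2, (pauliString a * A).trace • pauliString a =
      (2 : ℂ) ^ n • A := by
  ext x y
  simp only [Matrix.sum_apply, Matrix.smul_apply, smul_eq_mul, trace_mul_eq_sum, Finset.sum_mul]
  rw [Finset.sum_comm]
  calc ∑ u : Bits n, ∑ a, ∑ v, pauliString a u v * A v u * pauliString a x y
      = ∑ u : Bits n, ∑ v, A v u * ∑ a, pauliString a u v * pauliString a x y := by
        refine Finset.sum_congr rfl fun u _ => ?_
        rw [Finset.sum_comm]
        refine Finset.sum_congr rfl fun v _ => ?_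
        rw [Finset.mul_sum]
        exact Finset.sum_congr rfl fun a _ => by ring
    _ = _ := by
        simp only [pauliString_completeness]
        rw [Finset.sum_eq_single y, Finset.sum_eq_single x]
        · simp [mul_comm]
        · intro v _ hv; simp [hv]
        · simp
        · intro u _ hu; simp [hu]
        · simp

/-- Every operator is the combination of Pauli strings with its Pauli coefficients. -/
theorem pauli_expansion {n : ℕ} (A : Op n) :
    A = ((2 : ℂ) ^ n)⁻¹ • ∑ a : Fin n → Fin 2 × Fin 2, (pauliString a * A).trace •
      pauliString a := by
  rw [sum_trace_pauliString_smul, smul_smul, inv_mul_cancel₀ (by positivity), one_smul]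

theorem trace_mul_eq_sum_pauli {n : ℕ} (A B : Op n) :
    (A * B).trace = ((2 : ℂ) ^ n)⁻¹ * ∑ a : Fin n → Fin 2 × Fin 2,
      (pauliString a * B).trace * (A * pauliString a).trace := by
  conv_lhs => rw [pauli_expansion B]
  simp [Matrix.mul_sum, Matrix.trace_sum]

/-- Parseval: in the expansion of `Tr(A A†)` the two coefficients are complex conjugates, since
Pauli strings are Hermitian. -/
theorem sum_normSq_trace_pauliString {n : ℕ} (A : Op n) :
    ∑ a : Fin n → Fin 2 × Fin 2, ‖(A * pauliString a).trace‖ ^ 2 =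
      2 ^ n * ((Aᴴ * A).trace).re := by
  have h := trace_mul_eq_sum_pauli A Aᴴ
  have h2 : ∀ a : Fin n → Fin 2 × Fin 2, (pauliString a * Aᴴ).trace * (A * pauliString a).trace =
      ((‖(A * pauliString a).trace‖ ^ 2 : ℝ) : ℂ) := by
    intro a
    have : (pauliString a * Aᴴ).trace = star ((A * pauliString a).trace) := by
      rw [← Matrix.trace_conjTranspose, Matrix.conjTranspose_mul, pauliString_conjTranspose]
    rw [this, Complex.star_def, Complex.conj_mul']
    push_cast
    rfl
  simp only [h2] at h
  rw [← Complex.ofReal_sum] at h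
  rw [Matrix.trace_mul_comm, h, ← Complex.ofReal_ofNat, ← Complex.ofReal_pow,
    ← Complex.ofReal_inv, ← Complex.ofReal_mul, Complex.ofReal_re, mul_inv_cancel_left₀]
  positivity

/-- Each diagonal entry of `O†O` is the squared norm of the image of a basis vector, and there are
`2^n` of them. -/
theorem trace_conjTranspose_mul_le {n : ℕ} (O : Op n) :
    ((Oᴴ * O).trace).re ≤ 2 ^ n * opNorm O ^ 2 := by
  have key : ∀ y : Bits n, ((Oᴴ * O) y y).re ≤ opNorm O ^ 2 := by
    intro y
    have h1 := (Matrix.toEuclideanCLM (𝕜 := ℂ) O).le_opNorm (EuclideanSpace.single y 1)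
    rw [PiLp.norm_single, norm_one, mul_one] at h1
    have h2 : ((Oᴴ * O) y y).re =
        ‖Matrix.toEuclideanCLM (𝕜 := ℂ) O (EuclideanSpace.single y 1)‖ ^ 2 := by
      rw [EuclideanSpace.norm_sq_eq, Matrix.mul_apply, Complex.re_sum]
      refine Finset.sum_congr rfl fun x _ => ?_
      rw [Matrix.conjTranspose_apply, Complex.star_def, Complex.conj_mul']
      simp [← Complex.ofReal_pow]
    rw [h2, opNorm]
    gcongr
  rw [Matrix.trace, Complex.re_sum]
  refine (Finset.sum_le_sum fun y _ => key y).trans ?_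
  simp

/-- The Pauli coefficients of a local operator vanish outside its support. -/
theorem trace_mul_pauliString_eq_zero {n : ℕ} {O : Op n} {S : Finset (Fin n)}
    {T : Matrix (S → Fin 2) (S → Fin 2) ℂ}
    (hO : ∀ x y : Bits n,
      O x y = if ∀ i, i ∉ S → x i = y i then T (fun i => x i) (fun i => y i) else 0)
    {a : Fin n → Fin 2 × Fin 2} {j : Fin n} (hj : j ∉ S) (ha : a j ≠ (0, 0)) :
    (O * pauliString a).trace = 0 := by
  -- Expanding `T` in matrix units turns `O` into a combination of product operators with identity
  -- outside `S`. The trace against the Pauli string then factorizes, and the factor at `j` is the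
  -- trace of a non-identity Pauli.
  have hdecomp : O = ∑ u : S → Fin 2, ∑ v : S → Fin 2, T u v •
      tensor fun i => if h : i ∈ S then Matrix.single (u ⟨i, h⟩) (v ⟨i, h⟩) 1 else 1 := by
    have hprod : ∀ (u v : S → Fin 2) (x y : Bits n),
        tensor (fun i => if h : i ∈ S then Matrix.single (u ⟨i, h⟩) (v ⟨i, h⟩) 1 else 1) x y =
          if (∀ i, i ∉ S → x i = y i) ∧ u = (fun i : S => x i) ∧ v = (fun i : S => y i)
            then 1 else 0 := by
      intro u v x y
      have e : ∀ i, (if h : i ∈ S then Matrix.single (u ⟨i, h⟩) (v ⟨i, h⟩) (1 : ℂ)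
          else 1) (x i) (y i) =
          if (i ∉ S → x i = y i) ∧ ∀ h : i ∈ S, u ⟨i, h⟩ = x i ∧ v ⟨i, h⟩ = y i
            then 1 else 0 := by
        intro i
        by_cases h : i ∈ S
        · simp [h, Matrix.single_apply]
        · simp [h, Matrix.one_apply]
      simp only [tensor_apply, e]
      rw [prod_ite_one_zero, one_pow]
      congr 1
      simp only [forall_and, funext_iff, Subtype.forall]
    ext x y
    simp only [Matrix.sum_apply, Matrix.smul_apply, hprod, smul_eq_mul]
    rw [hO, Finset.sum_eq_single (fun i : S => x i), Finset.sum_eq_single (fun i : S => y i)]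
    · simp
    · intro v _ hv; simp [hv]
    · simp
    · intro u _ hu; simp [hu]
    · simp
  rw [hdecomp, Finset.sum_mul, Matrix.trace_sum]
  refine Finset.sum_eq_zero fun u _ => ?_
  rw [Finset.sum_mul, Matrix.trace_sum]
  refine Finset.sum_eq_zero fun v _ => ?_
  rw [Matrix.smul_mul, Matrix.trace_smul, pauliString, tensor_mul, trace_tensor,
    Finset.prod_eq_zero (Finset.mem_univ j), smul_zero]
  simp [hj, trace_pauli ha]

/-- Since `P` is Hermitian with `P² = 1`, `(1 ± P)†(1 ± P) = 2(1 ± P)`. Positivity of `ρ` then makes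
`t = Tr(Pρ)` real with `1 ± t ≥ 0`. -/
theorem norm_trace_pauliString_mul_le {n : ℕ} {ρ : Op n} (hρ : IsState ρ)
    (a : Fin n → Fin 2 × Fin 2) : ‖(pauliString a * ρ).trace‖ ≤ 1 := by
  have key : ∀ B : Op n, 0 ≤ (Bᴴ * B * ρ).trace := fun B => by
    rw [mul_assoc, Matrix.trace_mul_comm]
    exact (hρ.posSemidef.mul_mul_conjTranspose_same B).trace_nonneg
  have h1 := key (1 + pauliString a)
  have h2 := key (1 - pauliString a)
  simp only [Matrix.conjTranspose_add, Matrix.conjTranspose_sub, Matrix.conjTranspose_one,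
    pauliString_conjTranspose, mul_add, add_mul, mul_sub, sub_mul, one_mul, mul_one,
    Matrix.trace_add, Matrix.trace_sub, pauliString_mul_self, hρ.trace_eq_one] at h1 h2
  generalize (pauliString a * ρ).trace = t at h1 h2 ⊢
  rw [Complex.nonneg_iff] at h1 h2
  simp at h1 h2
  obtain ⟨r, i⟩ := t
  simp only at h1 h2
  obtain rfl : i = 0 := by linarith [h1.2]
  rw [show (⟨r, 0⟩ : ℂ) = (r : ℂ) from rfl, Complex.norm_real, Real.norm_eq_abs, abs_le]
  exact ⟨by linarith [h1.1], by linarith [h2.1]⟩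

/-! ### The twirl -/

theorem lbraket_basisState {n : ℕ} (b : Bits n) (A : Op n) : lbraket (basisState b) A = A b b := by
  simp [lbraket, basisState, Matrix.conjTranspose_single, Matrix.trace, Matrix.diag_apply,
    Matrix.mul_apply, Matrix.single_apply, ite_and]

theorem channel_apply {n : ℕ} (g : LocalClifford n) (A : Op n) :
    g.channel A = g.unitary * A * g.unitaryᴴ := rfl

theorem unitary_conjTranspose_mul {n : ℕ} (g : LocalClifford n) : g.unitaryᴴ * g.unitary = 1 := by
  simp only [LocalClifford.unitary, tensor_conjTranspose, tensor_mul, conjTranspose_mul_out,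
    tensor_one]

theorem channel_pauliString {n : ℕ} (g : LocalClifford n) (a : Fin n → Fin 2 × Fin 2) :
    g.channel (pauliString a) = tensor fun i => cliffordConj (g i) (a i) := by
  simp only [channel_apply, LocalClifford.unitary, pauliString, tensor_conjTranspose, tensor_mul]
  rfl

theorem trace_channel {n : ℕ} (g : LocalClifford n) (A : Op n) :
    (g.channel A).trace = A.trace := by
  rw [channel_apply, Matrix.trace_mul_comm, ← mul_assoc, unitary_conjTranspose_mul, one_mul]

theorem posSemidef_channel {n : ℕ} (g : LocalClifford n) {A : Op n} (hA : A.PosSemidef) :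
    (g.channel A).PosSemidef := hA.mul_mul_conjTranspose_same _

theorem weight_eq_sum {n : ℕ} (z : Bits n) : weight z = ∑ i, (z i).val := by
  rw [weight, Finset.card_filter]
  refine Finset.sum_congr rfl fun i _ => ?_
  generalize z i = t
  fin_cases t <;> simp

theorem pauliSupport_apply {n : ℕ} (a : Fin n → Fin 2 × Fin 2) (i : Fin n) :
    pauliSupport a i = suppBit (a i) := rfl

theorem pauliSupport_zero_left {n : ℕ} (z : Bits n) : pauliSupport (fun i => (0, z i)) = z := by
  funext i
  rw [pauliSupport_apply]
  generalize z i = t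
  fin_cases t <;> simp [suppBit]

/-- The sign `(-1)^{z·x}`. -/
def parity {n : ℕ} (z x : Bits n) : ℝ := (-1) ^ (∑ i, (z i).val * (x i).val)

theorem parity_mul_self {n : ℕ} (z x : Bits n) : parity z x * parity z x = 1 := by
  rw [parity, ← mul_pow]; simp

theorem parity_mul_parity {n : ℕ} (z x b : Bits n) :
    (-1 : ℝ) ^ (∑ i, (z i).val * (x i + b i).val) = parity z x * parity z b := by
  simp only [parity, ← Finset.prod_pow_eq_pow_sum, ← Finset.prod_mul_distrib]
  refine Finset.prod_congr rfl fun i _ => ?_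
  generalize z i = s
  generalize x i = t
  generalize b i = u
  fin_cases s <;> fin_cases t <;> fin_cases u <;> simp

theorem pauliZ_apply {n : ℕ} (z x y : Bits n) :
    pauliZ z x y = if x = y then (parity z x : ℂ) else 0 := by
  have e : ∀ s t u : Fin 2, pauli (0, s) t u = if t = u then (-1) ^ (s.val * t.val) else 0 := by
    intro s t u
    fin_cases s <;> fin_cases t <;> fin_cases u <;> simp [pauli]
  rw [pauliZ, pauliString, tensor_apply]
  split_ifs with h
  · subst h
    simp [e, parity, Finset.prod_pow_eq_pow_sum]
  · obtain ⟨i, hi⟩ := Function.ne_iff.1 h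
    exact Finset.prod_eq_zero (Finset.mem_univ i) (by simp [e, hi])

theorem pauliZ_eq_sum {n : ℕ} (z : Bits n) :
    pauliZ z = ∑ x : Bits n, (parity z x : ℂ) • basisState x := by
  ext x y
  simp only [pauliZ_apply, Matrix.sum_apply, Matrix.smul_apply, basisState, Matrix.single_apply,
    smul_eq_mul, mul_ite, mul_one, mul_zero]
  by_cases h : x = y
  · subst h; simp
  · simp only [h, if_false]
    refine (Finset.sum_eq_zero fun u _ => ?_).symm
    rw [if_neg]
    rintro ⟨rfl, rfl⟩
    exact h rfl

theorem sum_pauliZ {n : ℕ} : ∑ z : Bits n, pauliZ z = (2 : ℂ) ^ n • basisState 0 := by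
  have e : ∑ t : Fin 2, pauli (0, t) = (2 : ℂ) • Matrix.single 0 0 1 := by
    ext i j
    fin_cases i <;> fin_cases j <;> simp [Fin.sum_univ_two, pauli]
    norm_num
  simp only [pauliZ, pauliString]
  rw [sum_tensor fun _ t => pauli (0, t)]
  simp only [e]
  rw [tensor_smul]
  simp only [Finset.prod_const, Finset.card_univ, Fintype.card_fin]
  congr 1
  ext x y
  simp only [tensor_apply, basisState, Matrix.single_apply]
  rw [prod_ite_one_zero, one_pow]
  simp only [forall_and, funext_iff, Pi.zero_apply]

theorem card_localClifford (n : ℕ) :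
    Fintype.card (LocalClifford n) = Fintype.card Clifford₂ ^ n := by simp

/-- The second moments of the local Clifford group. -/
theorem sum_channel_apply_smul_channel {n : ℕ} (b : Bits n) (c a : Fin n → Fin 2 × Fin 2) :
    ∑ g : LocalClifford n, g.channel (pauliString c) b b • g.channel (pauliString a) =
      if c = a then ((Fintype.card (LocalClifford n) : ℂ) * 3⁻¹ ^ weight (pauliSupport a) *
        parity (pauliSupport a) b) • pauliZ (pauliSupport a) else 0 := by
  have h1 : ∀ g : LocalClifford n,
      g.channel (pauliString c) b b • g.channel (pauliString a) =
        tensor fun i => cliffordConj (g i) (c i) (b i) (b i) • cliffordConj (g i) (a i) := by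
    intro g
    rw [tensor_smul, channel_pauliString, channel_pauliString, tensor_apply]
  simp only [h1]
  rw [sum_tensor fun i t => cliffordConj t (c i) (b i) (b i) • cliffordConj t (a i)]
  -- The sum over a product group factorizes into single-qubit moments.
  change (tensor fun i => cliffordMoment (b i) (c i) (a i)) = _
  split_ifs with h
  · subst h
    simp only [cliffordMoment_self]
    rw [tensor_smul, card_localClifford, weight_eq_sum, parity]
    simp only [Finset.prod_mul_distrib, Finset.prod_pow_eq_pow_sum, pauliSupport_apply,
      Finset.prod_const, Finset.card_univ, Fintype.card_fin]
    push_cast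
    rfl
  · obtain ⟨i, hi⟩ := Function.ne_iff.1 h
    ext x y
    rw [tensor_apply, Matrix.zero_apply]
    exact Finset.prod_eq_zero (Finset.mem_univ i) (by rw [cliffordMoment_of_ne _ hi]; rfl)

/-! ### Positivity and normalization of the channel -/

/-- Complete positivity with a one-dimensional ancilla. -/
theorem IsQuantumChannel.posSemidef {n : ℕ} {Λ : SuperOp n} (hΛ : IsQuantumChannel Λ) {A : Op n}
    (hA : A.PosSemidef) : (Λ A).PosSemidef := by
  have h := (hΛ.completelyPositive 1 (A.submatrix Prod.snd Prod.snd)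
    (hA.submatrix Prod.snd)).submatrix fun x : Bits n => ((0 : Fin 1), x)
  exact h

theorem basisState_posSemidef {n : ℕ} (b : Bits n) : (basisState b).PosSemidef := by
  have : basisState b = basisState b * (basisState b)ᴴ := by
    simp [basisState, Matrix.conjTranspose_single]
  rw [this]
  exact Matrix.posSemidef_self_mul_conjTranspose _

theorem trace_basisState {n : ℕ} (b : Bits n) : (basisState b).trace = 1 := by
  simp [basisState]

theorem diag_nonneg {n : ℕ} {A : Op n} (hA : A.PosSemidef) (b : Bits n) : 0 ≤ (A b b).re :=
  (Complex.nonneg_iff.1 (hA.diag_nonneg (i := b))).1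

theorem coe_re_diag {n : ℕ} {A : Op n} (hA : A.IsHermitian) (b : Bits n) :
    (((A b b).re : ℝ) : ℂ) = A b b := hA.coe_re_apply_self b

theorem sum_re_diag {n : ℕ} (A : Op n) : ∑ b, (A b b).re = A.trace.re := by
  rw [Matrix.trace, Complex.re_sum]; rfl

/-- Because `P_z` is diagonal with entries `(-1)^{z·x}`, `Γ_Λ(z)` is the transfer coefficient
`2^{-n} Tr(P_z Λ(P_z))`. In this form it appears both in the twirl and in the mean of the estimator.
-/
theorem sum_parity_channel_pauliZ {n : ℕ} {Λ : SuperOp n} (hΛ : IsQuantumChannel Λ) (z : Bits n) :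
    ∑ b : Bits n, (parity z b : ℂ) * Λ (pauliZ z) b b = (2 : ℂ) ^ n * Gam Λ z := by
  rw [Gam]
  push_cast
  rw [mul_inv_cancel_left₀ (by positivity), Finset.sum_comm]
  refine Finset.sum_congr rfl fun b _ => ?_
  rw [pauliZ_eq_sum, map_sum, Matrix.sum_apply, Finset.mul_sum]
  refine Finset.sum_congr rfl fun x _ => ?_
  rw [lbraket_basisState,
    coe_re_diag (hΛ.posSemidef (basisState_posSemidef x)).isHermitian, map_smul,
    Matrix.smul_apply, smul_eq_mul]
  have := parity_mul_parity z x b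
  rw [← Complex.ofReal_inj] at this
  push_cast at this
  rw [this]
  ring

/-- The coefficients `f_z` of the noisy measurement channel. -/
def twirlCoeff {n : ℕ} (Λ : SuperOp n) (z : Bits n) : ℝ := 3⁻¹ ^ weight z * Gam Λ z

theorem eq_of_trace_pauliString_mul_eq {n : ℕ} {A B : Op n}
    (h : ∀ c, (pauliString c * A).trace = (pauliString c * B).trace) : A = B := by
  rw [pauli_expansion A, pauli_expansion B]
  simp only [h]

theorem dephasing_apply {n : ℕ} (A : Op n) :
    dephasing n A = ∑ b, A b b • basisState b := by
  simp [dephasing, lbraket_basisState]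

theorem card_localClifford_ne_zero (n : ℕ) : (Fintype.card (LocalClifford n) : ℂ) ≠ 0 :=
  Nat.cast_ne_zero.2 Fintype.card_ne_zero

theorem noisyTwirl_pauliString {n : ℕ} {Λ : SuperOp n} (hΛ : IsQuantumChannel Λ)
    (a : Fin n → Fin 2 × Fin 2) :
    noisyTwirl Λ (pauliString a) = (twirlCoeff Λ (pauliSupport a) : ℂ) • pauliString a := by
  refine eq_of_trace_pauliString_mul_eq fun c => ?_
  -- Cyclicity of the trace moves `𝒰†` onto `P_c`, and linearity brings the scalar inside `Λ`.
  -- Summing over `g` then acts on the argument of `Λ` alone, as a second moment of the group.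
  have h1 : ∀ g : LocalClifford n,
      (pauliString c * g.channelAdj (dephasing n (Λ (g.channel (pauliString a))))).trace =
        ∑ b, Λ (g.channel (pauliString c) b b • g.channel (pauliString a)) b b := by
    intro g
    rw [LocalClifford.channelAdj]
    change (pauliString c * (g.unitaryᴴ * _ * g.unitaryᴴᴴ)).trace = _
    rw [Matrix.conjTranspose_conjTranspose, ← mul_assoc, Matrix.trace_mul_comm, ← mul_assoc,
      ← mul_assoc, ← channel_apply, dephasing_apply, Finset.mul_sum, Matrix.trace_sum]
    refine Finset.sum_congr rfl fun b _ => ?_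
    rw [Matrix.mul_smul, Matrix.trace_smul, map_smul, Matrix.smul_apply, basisState,
      Matrix.trace_mul_single]
    simp [mul_comm]
  have h2 : (pauliString c * noisyTwirl Λ (pauliString a)).trace =
      (Fintype.card (LocalClifford n) : ℂ)⁻¹ * ∑ b, Λ (∑ g : LocalClifford n,
        g.channel (pauliString c) b b • g.channel (pauliString a)) b b := by
    simp only [noisyTwirl, LinearMap.smul_apply, LinearMap.sum_apply, LinearMap.comp_apply,
      Matrix.mul_smul, Finset.mul_sum, Matrix.trace_smul, Matrix.trace_sum, h1, map_sum,
      Matrix.sum_apply, smul_eq_mul]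
    rw [Finset.sum_comm]
  rw [h2]
  simp only [sum_channel_apply_smul_channel]
  rw [Matrix.mul_smul, Matrix.trace_smul, trace_pauliString_mul_pauliString]
  split_ifs with h
  · have h3 := sum_parity_channel_pauliZ hΛ (pauliSupport a)
    simp only [map_smul, Matrix.smul_apply, smul_eq_mul, mul_assoc, ← Finset.mul_sum, h3]
    rw [inv_mul_cancel_left₀ (card_localClifford_ne_zero n), twirlCoeff]
    push_cast
    ring
  · simp

/-! ### Moments of the single-round estimator -/

theorem roundProb_nonneg {n : ℕ} {Λ : SuperOp n} (hΛ : IsQuantumChannel Λ) (o : Round n) :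
    0 ≤ roundProb Λ o := by
  rw [roundProb, lbraket_basisState]
  exact mul_nonneg (by positivity)
    (diag_nonneg (hΛ.posSemidef (posSemidef_channel _ (basisState_posSemidef _))) _)

theorem sum_outcome {n : ℕ} {Λ : SuperOp n} (hΛ : IsQuantumChannel Λ) (g : LocalClifford n) :
    ∑ b, (Λ (g.channel (basisState 0)) b b).re = 1 := by
  rw [sum_re_diag, hΛ.tracePreserving, trace_channel, trace_basisState, Complex.one_re]

theorem card_localClifford_ne_zero_real (n : ℕ) : (Fintype.card (LocalClifford n) : ℝ) ≠ 0 :=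
  Nat.cast_ne_zero.2 Fintype.card_ne_zero

theorem sum_roundProb {n : ℕ} {Λ : SuperOp n} (hΛ : IsQuantumChannel Λ) :
    ∑ o : Round n, roundProb Λ o = 1 := by
  simp only [roundProb, lbraket_basisState, Fintype.sum_prod_type, ← Finset.mul_sum,
    sum_outcome hΛ]
  rw [Finset.sum_const, Finset.card_univ, nsmul_eq_mul, mul_one,
    inv_mul_cancel₀ (card_localClifford_ne_zero_real n)]

theorem channel_pauliZ_isHermitian {n : ℕ} (g : LocalClifford n) (z : Bits n) :
    (g.channel (pauliZ z)).IsHermitian := by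
  rw [Matrix.IsHermitian, pauliZ, channel_pauliString, tensor_conjTranspose]
  simp only [cliffordConj_conjTranspose]

/-- The initial state is the average of all `P_{z'}`; orthogonality of the second moments keeps only
`z' = z`. -/
theorem sum_roundProb_mul_noiseEst {n : ℕ} {Λ : SuperOp n} (hΛ : IsQuantumChannel Λ)
    (z : Bits n) : ∑ o : Round n, roundProb Λ o * noiseEst z o = twirlCoeff Λ z := by
  have h0 : ∀ b : Bits n, ∑ g : LocalClifford n,
      g.channel (pauliZ z) b b • g.channel (basisState 0) =
        (((2 : ℂ) ^ n)⁻¹ * ((Fintype.card (LocalClifford n) : ℂ) * 3⁻¹ ^ weight z *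
          parity z b)) • pauliZ z := by
    intro b
    have hb : basisState (0 : Bits n) = ((2 : ℂ) ^ n)⁻¹ • ∑ z' : Bits n, pauliZ z' := by
      rw [sum_pauliZ, smul_smul, inv_mul_cancel₀ (by positivity), one_smul]
    rw [hb]
    simp only [map_smul, map_sum, Finset.smul_sum]
    rw [Finset.sum_comm, Finset.sum_eq_single z]
    · have := sum_channel_apply_smul_channel b (fun i => (0, z i)) (fun i => (0, z i))
      rw [if_pos rfl, pauliSupport_zero_left] at this
      simp only [smul_comm _ ((2 : ℂ) ^ n)⁻¹]
      rw [← Finset.smul_sum, ← smul_smul, ← this]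
      rfl
    · intro z' _ hz'
      have := sum_channel_apply_smul_channel b (fun i => (0, z i)) (fun i => (0, z' i))
      rw [if_neg (fun h => hz' (funext fun i => (congrArg Prod.snd (congrFun h i)).symm))] at this
      simp only [smul_comm _ ((2 : ℂ) ^ n)⁻¹]
      rw [← Finset.smul_sum]
      change ((2 : ℂ) ^ n)⁻¹ • ∑ g : LocalClifford n, g.channel (pauliString fun i => (0, z i)) b b •
        g.channel (pauliString fun i => (0, z' i)) = 0
      rw [this, smul_zero]
    · simp
  rw [← Complex.ofReal_inj]
  push_cast
  have h1 : ∀ o : Round n, (roundProb Λ o : ℂ) * (noiseEst z o : ℂ) =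
      (Fintype.card (LocalClifford n) : ℂ)⁻¹ *
        Λ (o.1.channel (pauliZ z) o.2 o.2 • o.1.channel (basisState 0)) o.2 o.2 := by
    intro o
    rw [roundProb, noiseEst, lbraket_basisState, lbraket_basisState]
    push_cast
    rw [coe_re_diag (channel_pauliZ_isHermitian _ _), coe_re_diag
      (hΛ.posSemidef (posSemidef_channel _ (basisState_posSemidef _))).isHermitian, map_smul,
      Matrix.smul_apply, smul_eq_mul]
    ring
  simp only [h1]
  rw [← Finset.mul_sum, Fintype.sum_prod_type, Finset.sum_comm]
  have h2 : ∀ b : Bits n, ∑ g : LocalClifford n,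
      Λ (g.channel (pauliZ z) b b • g.channel (basisState 0)) b b =
        (((2 : ℂ) ^ n)⁻¹ * ((Fintype.card (LocalClifford n) : ℂ) * 3⁻¹ ^ weight z)) *
          (parity z b * Λ (pauliZ z) b b) := by
    intro b
    rw [← Matrix.sum_apply, ← map_sum, h0, map_smul, Matrix.smul_apply, smul_eq_mul]
    ring
  simp only [h2]
  rw [← Finset.mul_sum, sum_parity_channel_pauliZ hΛ, twirlCoeff]
  have hG := card_localClifford_ne_zero n
  push_cast
  field_simp

/-- A rotated non-identity Pauli is traceless, so its two diagonal entries are opposite. Hence the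
squared estimator depends on the gate and not on the outcome. -/
theorem cliffordConj_diag_sq (g : Clifford₂) (t b : Fin 2) :
    cliffordConj g (0, t) b b ^ 2 = cliffordConj g (0, t) 0 0 ^ 2 := by
  by_cases ht : t = 0
  · subst ht
    simp [cliffordConj_zero]
  · have h := trace_cliffordConj g (a := (0, t)) (by simp [ht])
    rw [Matrix.trace_fin_two] at h
    fin_cases b
    · rfl
    · have : cliffordConj g (0, t) 1 1 = - cliffordConj g (0, t) 0 0 := by
        linear_combination h
      simp [this]

theorem channel_pauliZ_diag_sq {n : ℕ} (g : LocalClifford n) (z b : Bits n) :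
    g.channel (pauliZ z) b b ^ 2 = g.channel (pauliZ z) 0 0 ^ 2 := by
  simp only [pauliZ, channel_pauliString, tensor_apply, ← Finset.prod_pow]
  exact Finset.prod_congr rfl fun i _ => cliffordConj_diag_sq _ _ _

/-- As the square ignores the outcome, the outcome probabilities sum to `1` and `Λ` drops out; a
pure second moment of the group remains. -/
theorem sum_roundProb_mul_noiseEst_sq {n : ℕ} {Λ : SuperOp n} (hΛ : IsQuantumChannel Λ)
    (z : Bits n) : ∑ o : Round n, roundProb Λ o * noiseEst z o ^ 2 = 3⁻¹ ^ weight z := by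
  have hre : ∀ (g : LocalClifford n) (b : Bits n),
      (((g.channel (pauliZ z) b b).re ^ 2 : ℝ) : ℂ) = g.channel (pauliZ z) b b ^ 2 := by
    intro g b
    rw [Complex.ofReal_pow, coe_re_diag (channel_pauliZ_isHermitian _ _)]
  have h1 : ∀ o : Round n, noiseEst z o ^ 2 = (o.1.channel (pauliZ z) 0 0).re ^ 2 := by
    intro o
    rw [noiseEst, lbraket_basisState, ← Complex.ofReal_inj, hre, hre, channel_pauliZ_diag_sq]
  have h2 : ∑ g : LocalClifford n, (g.channel (pauliZ z) 0 0).re ^ 2 =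
      Fintype.card (LocalClifford n) * 3⁻¹ ^ weight z := by
    rw [← Complex.ofReal_inj, Complex.ofReal_sum]
    simp only [hre]
    have := sum_channel_apply_smul_channel 0 (fun i => (0, z i)) (fun i => (0, z i))
    rw [if_pos rfl, pauliSupport_zero_left] at this
    have := congrFun (congrFun this 0) 0
    rw [Matrix.sum_apply] at this
    simp only [Matrix.smul_apply, smul_eq_mul, ← pow_two, pauliZ_apply, if_true] at this
    change ∑ g : LocalClifford n, g.channel (pauliString fun i => (0, z i)) 0 0 ^ 2 = _
    rw [this]
    simp [parity]
  simp only [h1, roundProb, lbraket_basisState, Fintype.sum_prod_type]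
  have h3 : ∀ g : LocalClifford n, ∑ b, (Fintype.card (LocalClifford n) : ℝ)⁻¹ *
      (Λ (g.channel (basisState 0)) b b).re * (g.channel (pauliZ z) 0 0).re ^ 2 =
        (Fintype.card (LocalClifford n) : ℝ)⁻¹ * (g.channel (pauliZ z) 0 0).re ^ 2 := by
    intro g
    rw [← Finset.sum_mul, ← Finset.mul_sum, sum_outcome hΛ, mul_one]
  simp only [h3]
  rw [← Finset.mul_sum, h2, inv_mul_cancel_left₀ (card_localClifford_ne_zero_real n)]

/-! ### Bounds on the noise parameters -/

theorem transition_nonneg {n : ℕ} {Λ : SuperOp n} (hΛ : IsQuantumChannel Λ) (x b : Bits n) :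
    0 ≤ (lbraket (basisState b) (Λ (basisState x))).re := by
  rw [lbraket_basisState]
  exact diag_nonneg (hΛ.posSemidef (basisState_posSemidef _)) _

theorem sum_transition {n : ℕ} {Λ : SuperOp n} (hΛ : IsQuantumChannel Λ) (x : Bits n) :
    ∑ b, (lbraket (basisState b) (Λ (basisState x))).re = 1 := by
  simp only [lbraket_basisState]
  rw [sum_re_diag, hΛ.tracePreserving, trace_basisState, Complex.one_re]

/-- For each input `x` with return probability `p`, the sign at `b = x` is `+1` and the other terms
total at least `-(1 - p)`. Averaging `2p - 1` over `x` gives the bound. -/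
theorem two_mul_fidelityZ_sub_one_le_Gam {n : ℕ} {Λ : SuperOp n} (hΛ : IsQuantumChannel Λ)
    (z : Bits n) : 2 * fidelityZ Λ - 1 ≤ Gam Λ z := by
  have h : ∀ x : Bits n, 2 * (lbraket (basisState x) (Λ (basisState x))).re - 1 ≤
      ∑ b : Bits n, (-1 : ℝ) ^ (∑ i, (z i).val * (x i + b i).val) *
        (lbraket (basisState b) (Λ (basisState x))).re := by
    intro x
    have h0 := sum_transition hΛ x
    rw [← Finset.add_sum_erase _ _ (Finset.mem_univ x)] at h0
    rw [← Finset.add_sum_erase Finset.univ (fun b : Bits n =>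
        (-1 : ℝ) ^ (∑ i, (z i).val * (x i + b i).val) *
          (lbraket (basisState b) (Λ (basisState x))).re) (Finset.mem_univ x)]
    have h1 : (-1 : ℝ) ^ (∑ i, (z i).val * (x i + x i).val) = 1 := by
      rw [parity_mul_parity, parity_mul_self]
    have h2 : -∑ b ∈ Finset.univ.erase x, (lbraket (basisState b) (Λ (basisState x))).re ≤
        ∑ b ∈ Finset.univ.erase x, (-1 : ℝ) ^ (∑ i, (z i).val * (x i + b i).val) *
          (lbraket (basisState b) (Λ (basisState x))).re := by
      rw [← Finset.sum_neg_distrib]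
      refine Finset.sum_le_sum fun b _ => ?_
      have := transition_nonneg hΛ x b
      rcases neg_one_pow_eq_or ℝ (∑ i, (z i).val * (x i + b i).val) with h | h <;> rw [h] <;>
        linarith
    rw [h1]
    linarith
  have h2 := Finset.sum_le_sum fun x (_ : x ∈ Finset.univ) => h x
  rw [Finset.sum_sub_distrib, ← Finset.mul_sum] at h2
  simp only [Finset.sum_const, Finset.card_univ, Fintype.card_pi, Fintype.card_fin,
    Finset.prod_const, nsmul_eq_mul, mul_one] at h2
  push_cast at h2
  have hpos : (0 : ℝ) < 2 ^ n := by positivity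
  have h3 := mul_le_mul_of_nonneg_left h2 (inv_pos.2 hpos).le
  rw [mul_sub, inv_mul_cancel₀ hpos.ne'] at h3
  rw [fidelityZ, Gam]
  linarith

theorem fidelityZ_le_one {n : ℕ} {Λ : SuperOp n} (hΛ : IsQuantumChannel Λ) :
    fidelityZ Λ ≤ 1 := by
  rw [fidelityZ, inv_mul_le_iff₀ (by positivity), mul_one]
  calc _ ≤ ∑ _b : Bits n, (1 : ℝ) := Finset.sum_le_sum fun b _ => by
        rw [← sum_transition hΛ b]
        exact Finset.single_le_sum (fun x _ => transition_nonneg hΛ b x) (Finset.mem_univ b)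
    _ = 2 ^ n := by simp

theorem Gam_zero {n : ℕ} {Λ : SuperOp n} (hΛ : IsQuantumChannel Λ) : Gam Λ 0 = 1 := by
  simp [Gam, sum_transition hΛ]

/-! ### Median of means for a finite probability distribution -/

section MedianOfMeans

variable {R : Type*} [Fintype R]

theorem sum_prod_weight {w : R → ℝ} (hw : ∑ o, w o = 1) (N : ℕ) :
    ∑ η : Fin N → R, ∏ s, w (η s) = 1 := by
  rw [← Fintype.sum_pow, hw, one_pow]

theorem sum_fin_succ (N : ℕ) (F : (Fin (N + 1) → R) → ℝ) :
    ∑ η, F η = ∑ o : R, ∑ η : Fin N → R, F (Fin.cons o η) := by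
  rw [← (Fin.consEquiv fun _ : Fin (N + 1) => R).sum_comp, Fintype.sum_prod_type]
  rfl

theorem sum_prod_weight_mul_sum {w Y : R → ℝ} (hw : ∑ o, w o = 1) (hY : ∑ o, w o * Y o = 0)
    (N : ℕ) : ∑ η : Fin N → R, (∏ s, w (η s)) * ∑ s, Y (η s) = 0 := by
  induction N with
  | zero => simp
  | succ N ih =>
    rw [sum_fin_succ]
    simp only [Fin.prod_univ_succ, Fin.sum_univ_succ, Fin.cons_zero, Fin.cons_succ]
    have h : ∀ o, ∑ η : Fin N → R, w o * (∏ s, w (η s)) * (Y o + ∑ s, Y (η s)) = w o * Y o := by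
      intro o
      calc _ = w o * Y o * (∑ η : Fin N → R, ∏ s, w (η s)) +
            w o * ∑ η : Fin N → R, (∏ s, w (η s)) * ∑ s, Y (η s) := by
            rw [Finset.mul_sum, Finset.mul_sum, ← Finset.sum_add_distrib]
            exact Finset.sum_congr rfl fun η _ => by ring
        _ = _ := by rw [sum_prod_weight hw, ih]; ring
    simp only [h, hY]

/-- Splitting off the first sample, the cross term vanishes by centering, so variances add. -/
theorem sum_prod_weight_mul_sum_sq {w Y : R → ℝ} (hw : ∑ o, w o = 1)
    (hY : ∑ o, w o * Y o = 0) (N : ℕ) :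
    ∑ η : Fin N → R, (∏ s, w (η s)) * (∑ s, Y (η s)) ^ 2 = N * ∑ o, w o * Y o ^ 2 := by
  induction N with
  | zero => simp
  | succ N ih =>
    rw [sum_fin_succ]
    simp only [Fin.prod_univ_succ, Fin.sum_univ_succ, Fin.cons_zero, Fin.cons_succ]
    have h : ∀ o, ∑ η : Fin N → R, w o * (∏ s, w (η s)) * (Y o + ∑ s, Y (η s)) ^ 2 =
        w o * Y o ^ 2 + w o * (N * ∑ o, w o * Y o ^ 2) := by
      intro o
      calc _ = w o * Y o ^ 2 * (∑ η : Fin N → R, ∏ s, w (η s)) +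
            2 * w o * Y o * (∑ η : Fin N → R, (∏ s, w (η s)) * ∑ s, Y (η s)) +
            w o * ∑ η : Fin N → R, (∏ s, w (η s)) * (∑ s, Y (η s)) ^ 2 := by
            rw [Finset.mul_sum, Finset.mul_sum, Finset.mul_sum, ← Finset.sum_add_distrib,
              ← Finset.sum_add_distrib]
            exact Finset.sum_congr rfl fun η _ => by ring
        _ = _ := by rw [sum_prod_weight hw, ih, sum_prod_weight_mul_sum hw hY]; ring
    simp only [h]
    rw [Finset.sum_add_distrib, ← Finset.sum_mul, hw]
    push_cast
    ring

open scoped Classical in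
/-- Chebyshev's inequality for the mean of `N` independent samples. -/
theorem sum_mean_deviation_le {w X : R → ℝ} (hw0 : ∀ o, 0 ≤ w o) (hw : ∑ o, w o = 1) {f v t : ℝ}
    (hf : ∑ o, w o * X o = f) (hv : ∑ o, w o * X o ^ 2 ≤ v) (ht : 0 < t) {N : ℕ} (hN : 0 < N) :
    ∑ η : Fin N → R, (∏ s, w (η s)) *
      (if t < |(N : ℝ)⁻¹ * ∑ s, X (η s) - f| then 1 else 0) ≤ v / (N * t ^ 2) := by
  have hN' : (0 : ℝ) < N := Nat.cast_pos.2 hN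
  have hY : ∑ o, w o * (X o - f) = 0 := by
    simp only [mul_sub, Finset.sum_sub_distrib, ← Finset.sum_mul, hf, hw]; ring
  -- Centering subtracts `f²`, so the raw second moment bounds the variance.
  have hY2 : ∑ o, w o * (X o - f) ^ 2 ≤ v := by
    have : ∑ o, w o * (X o - f) ^ 2 =
        ∑ o, w o * X o ^ 2 - 2 * f * ∑ o, w o * X o + f ^ 2 * ∑ o, w o := by
      rw [Finset.mul_sum, Finset.mul_sum, ← Finset.sum_sub_distrib, ← Finset.sum_add_distrib]
      exact Finset.sum_congr rfl fun o _ => by ring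
    rw [this, hf, hw]
    nlinarith [sq_nonneg f]
  calc _ ≤ ∑ η : Fin N → R, (N ^ 2 * t ^ 2 : ℝ)⁻¹ *
        ((∏ s, w (η s)) * (∑ s, (X (η s) - f)) ^ 2) := by
        refine Finset.sum_le_sum fun η _ => ?_
        have hW : 0 ≤ ∏ s, w (η s) := Finset.prod_nonneg fun s _ => hw0 _
        have e : (N : ℝ)⁻¹ * ∑ s, X (η s) - f = (N : ℝ)⁻¹ * ∑ s, (X (η s) - f) := by
          rw [Finset.sum_sub_distrib]
          simp
          field_simp
        rw [mul_left_comm]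
        refine mul_le_mul_of_nonneg_left ?_ hW
        split_ifs with h
        · rw [e] at h
          have h2 : t ^ 2 ≤ ((N : ℝ)⁻¹ * ∑ s, (X (η s) - f)) ^ 2 := by
            rw [← sq_abs (_ * _)]
            exact pow_le_pow_left₀ ht.le h.le 2
          rw [mul_pow, inv_pow, le_inv_mul_iff₀ (by positivity)] at h2
          rw [le_inv_mul_iff₀ (by positivity)]
          linarith
        · positivity
    _ = (N ^ 2 * t ^ 2 : ℝ)⁻¹ * (N * ∑ o, w o * (X o - f) ^ 2) := by
        rw [← Finset.mul_sum, sum_prod_weight_mul_sum_sq hw hY]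
    _ ≤ (N ^ 2 * t ^ 2 : ℝ)⁻¹ * (N * v) := by gcongr
    _ = _ := by field_simp

open scoped Classical in
/-- At least half of `K` independent events of small probability occur with exponentially small
probability. -/
theorem sum_majority_le {w : R → ℝ} (hw0 : ∀ o, 0 ≤ w o) (hw : ∑ o, w o = 1) {N : ℕ}
    (bad : (Fin N → R) → Prop)
    (hbad : ∑ η : Fin N → R, (∏ s, w (η s)) * (if bad η then 1 else 0) ≤ 1 / 16) (K : ℕ) :
    ∑ ω : Fin K × Fin N → R, (∏ p, w (ω p)) *
      (if K ≤ 2 * (Finset.univ.filter fun t => bad fun s => ω (t, s)).card then 1 else 0) ≤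
        (1 / 2) ^ K := by
  -- Chernoff weights: the product of `4` per bad group and `1/4` per good one is at least `1` when
  -- half are bad. Its mean per group is at most `1/4 + (15/4)(1/16) = 31/64 < 1/2`.
  have hh : ∑ η : Fin N → R, (∏ s, w (η s)) * (if bad η then 4 else 1 / 4) ≤ (1 / 2 : ℝ) := by
    have : ∀ η : Fin N → R, (∏ s, w (η s)) * (if bad η then 4 else 1 / 4 : ℝ) =
        1 / 4 * (∏ s, w (η s)) + 15 / 4 * ((∏ s, w (η s)) * (if bad η then 1 else 0)) := by
      intro η; split_ifs <;> ring
    simp only [this]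
    rw [Finset.sum_add_distrib, ← Finset.mul_sum, ← Finset.mul_sum, sum_prod_weight hw]
    linarith
  have hh0 : 0 ≤ ∑ η : Fin N → R, (∏ s, w (η s)) * (if bad η then 4 else 1 / 4 : ℝ) :=
    Finset.sum_nonneg fun η _ => mul_nonneg (Finset.prod_nonneg fun s _ => hw0 _)
      (by split_ifs <;> norm_num)
  calc _ ≤ ∑ ω : Fin K × Fin N → R, ∏ t, ((∏ s, w (ω (t, s))) *
        (if bad fun s => ω (t, s) then 4 else 1 / 4 : ℝ)) := by
        refine Finset.sum_le_sum fun ω _ => ?_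
        rw [Fintype.prod_prod_type, Finset.prod_mul_distrib]
        refine mul_le_mul_of_nonneg_left ?_
          (Finset.prod_nonneg fun t _ => Finset.prod_nonneg fun s _ => hw0 _)
        split_ifs with h
        · rw [Finset.prod_ite, Finset.prod_const, Finset.prod_const]
          have hc := Finset.card_filter_add_card_filter_not (s := (Finset.univ : Finset (Fin K)))
            (fun t => bad fun s => ω (t, s))
          rw [Finset.card_univ, Fintype.card_fin] at hc
          rw [one_div, inv_pow, ← div_eq_mul_inv, le_div_iff₀ (by positivity), one_mul]
          exact pow_le_pow_right₀ (by norm_num) (by omega)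
        · exact Finset.prod_nonneg fun t _ => by split_ifs <;> norm_num
    _ = ∑ ω : Fin K → Fin N → R, ∏ t, ((∏ s, w (ω t s)) *
        (if bad (ω t) then 4 else 1 / 4 : ℝ)) :=
        (Equiv.curry (Fin K) (Fin N) R).sum_comp fun ω => ∏ t, ((∏ s, w (ω t s)) *
          (if bad (ω t) then 4 else 1 / 4 : ℝ))
    _ = (∑ η : Fin N → R, (∏ s, w (η s)) * (if bad η then 4 else 1 / 4 : ℝ)) ^ K := by
        rw [Fintype.sum_pow]
    _ ≤ _ := pow_le_pow_left₀ hh0 hh K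

end MedianOfMeans

/-- If fewer than half of the entries are farther than `t` from `f`, the median is within `t`. -/
theorem abs_median_sub_le {K : ℕ} (v : Fin K → ℝ) {f t : ℝ}
    (h : 2 * (Finset.univ.filter fun i => t < |v i - f|).card < K) : |median v - f| ≤ t := by
  have hmono : Monotone (v ∘ Tuple.sort v) := Tuple.monotone_sort v
  have hcard : ∀ s : Finset (Fin K), (∀ i ∈ s, t < |v (Tuple.sort v i) - f|) → 2 * s.card < K := by
    intro s hs
    have hle : (s.map (Tuple.sort v).toEmbedding).card ≤
        (Finset.univ.filter fun i => t < |v i - f|).card := by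
      refine Finset.card_le_card fun i hi => ?_
      obtain ⟨j, hj, rfl⟩ := Finset.mem_map.1 hi
      exact Finset.mem_filter.2 ⟨Finset.mem_univ _, hs j hj⟩
    rw [Finset.card_map] at hle
    omega
  -- If the sorted entry `i` is too large, so are the `K - i` entries from it upwards; if too small,
  -- so are the `i + 1` entries up to it. Both counts are at least `K / 2` under these conditions,
  -- which hold for both middle indices.
  have key : ∀ i : Fin K, K ≤ 2 * (i.val + 1) → 2 * i.val ≤ K →
      |v (Tuple.sort v i) - f| ≤ t := by
    intro i h1 h2
    by_contra hc
    rw [not_le, lt_abs] at hc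
    rcases hc with hc | hc
    · have := hcard (Finset.Ici i) fun j hj => by
        have := hmono (Finset.mem_Ici.1 hj)
        simp only [Function.comp_apply] at this
        rw [lt_abs]
        left; linarith
      rw [Fin.card_Ici] at this
      omega
    · have := hcard (Finset.Iic i) fun j hj => by
        have := hmono (Finset.mem_Iic.1 hj)
        simp only [Function.comp_apply] at this
        rw [lt_abs]
        right; linarith
      rw [Fin.card_Iic] at this
      omega
  have hK : 0 < K := by omega
  have e1 := abs_le.1 (key ⟨(K - 1) / 2, by omega⟩ (by simp only; omega) (by simp only; omega))
  have e2 := abs_le.1 (key ⟨K / 2, by omega⟩ (by simp only; omega) (by simp only; omega))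
  rw [median, dif_pos hK, abs_le]
  constructor <;> linarith [e1.1, e1.2, e2.1, e2.2]

/-! ### The law of the record -/

theorem roundLaw_singleton {n : ℕ} (Λ : SuperOp n) (o : Round n) :
    roundLaw Λ {o} = ENNReal.ofReal (roundProb Λ o) := by
  classical
  rw [roundLaw, MeasureTheory.Measure.finsetSum_apply]
  simp only [MeasureTheory.Measure.smul_apply, MeasureTheory.Measure.dirac_apply,
    smul_eq_mul, Set.indicator_apply, Set.mem_singleton_iff, Pi.one_apply, mul_ite, mul_one,
    mul_zero]
  simp

theorem isProbabilityMeasure_roundLaw {n : ℕ} {Λ : SuperOp n} (hΛ : IsQuantumChannel Λ) :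
    MeasureTheory.IsProbabilityMeasure (roundLaw Λ) := by
  refine ⟨?_⟩
  rw [roundLaw, MeasureTheory.Measure.finsetSum_apply]
  simp only [MeasureTheory.Measure.smul_apply, MeasureTheory.measure_univ, smul_eq_mul, mul_one]
  rw [← ENNReal.ofReal_sum_of_nonneg fun o _ => roundProb_nonneg hΛ o, sum_roundProb hΛ,
    ENNReal.ofReal_one]

/-- The record space is finite, so the product measure is a sum of product weights and the
finite-sum inequalities above apply. -/
theorem calibrationLaw_apply {n : ℕ} {Λ : SuperOp n} (hΛ : IsQuantumChannel Λ) {N K : ℕ}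
    (p : Record n N K → Prop) [DecidablePred p] : calibrationLaw Λ N K {ω | p ω} =
      ENNReal.ofReal (∑ ω, (∏ i, roundProb Λ (ω i)) * (if p ω then 1 else 0)) := by
  classical
  have := isProbabilityMeasure_roundLaw hΛ
  have hs : {ω | p ω} = ((Finset.univ.filter p : Finset (Record n N K)) : Set _) := by
    ext; simp
  rw [hs, ← MeasureTheory.sum_measure_singleton]
  simp only [mul_ite, mul_one, mul_zero]
  rw [← Finset.sum_filter, ENNReal.ofReal_sum_of_nonneg fun ω _ =>
    Finset.prod_nonneg fun i _ => roundProb_nonneg hΛ _]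
  refine Finset.sum_congr rfl fun ω _ => ?_
  rw [calibrationLaw, MeasureTheory.Measure.pi_singleton,
    ENNReal.ofReal_prod_of_nonneg fun i _ => roundProb_nonneg hΛ _]
  simp only [roundLaw_singleton]

theorem measure_fHat_deviation_le {n : ℕ} {Λ : SuperOp n} (hΛ : IsQuantumChannel Λ) (z : Bits n)
    {t : ℝ} (ht : 0 < t) {N : ℕ} (hN : 0 < N) (K : ℕ)
    (h : 3⁻¹ ^ weight z / (N * t ^ 2) ≤ 1 / 16) :
    calibrationLaw Λ N K {ω | t < |fHat ω z - twirlCoeff Λ z|} ≤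
      ENNReal.ofReal ((1 / 2) ^ K) := by
  classical
  have h1 := sum_majority_le (roundProb_nonneg hΛ) (sum_roundProb hΛ)
    (fun η : Fin N → Round n => t < |(N : ℝ)⁻¹ * ∑ s, noiseEst z (η s) - twirlCoeff Λ z|)
    ((sum_mean_deviation_le (roundProb_nonneg hΛ) (sum_roundProb hΛ)
      (sum_roundProb_mul_noiseEst hΛ z) (sum_roundProb_mul_noiseEst_sq hΛ z).le ht hN).trans h) K
  refine le_trans (MeasureTheory.measure_mono fun ω hω => ?_)
    ((calibrationLaw_apply hΛ fun ω => _).trans_le (ENNReal.ofReal_le_ofReal h1))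
  by_contra hc
  exact absurd (abs_median_sub_le _ (not_le.1 hc)) (not_le.2 hω)

/-! ### The error of the calibrated inverse -/

theorem proj_pauliString {n : ℕ} (z : Bits n) (a : Fin n → Fin 2 × Fin 2) :
    proj z (pauliString a) = if pauliSupport a = z then pauliString a else 0 := by
  change (∑ c : Fin n → Fin 2 × Fin 2, if pauliSupport c = z then
    ((2 : ℂ) ^ n)⁻¹ • lbraket (pauliString c) (pauliString a) • pauliString c else 0) = _
  simp only [lbraket, pauliString_conjTranspose, trace_pauliString_mul_pauliString]
  rw [Finset.sum_eq_single a]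
  · rw [if_pos rfl, smul_smul, inv_mul_cancel₀ (by positivity), one_smul]
  · intro c _ hc
    simp [hc]
  · simp

theorem invEstimate_pauliString {n N K : ℕ} (ω : Record n N K) (a : Fin n → Fin 2 × Fin 2) :
    invEstimate ω (pauliString a) =
      (((fHat ω (pauliSupport a))⁻¹ : ℝ) : ℂ) • pauliString a := by
  rw [invEstimate, LinearMap.sum_apply, Finset.sum_eq_single (pauliSupport a)]
  · simp [proj_pauliString]
  · intro z _ hz
    simp [proj_pauliString, hz.symm]
  · simp

/-- Both superoperators are diagonal in the Pauli basis, so their composition rescales each term of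
the expansion of `Tr(Oρ)` by `f_z / f̂_z`. -/
theorem error_eq_sum {n N K : ℕ} {Λ : SuperOp n} (hΛ : IsQuantumChannel Λ) (ω : Record n N K)
    {O : Op n} (hO : O.IsHermitian) (ρ : Op n) :
    lbraket O (invEstimate ω (noisyTwirl Λ ρ)) - (O * ρ).trace =
      ((2 : ℂ) ^ n)⁻¹ * ∑ a : Fin n → Fin 2 × Fin 2,
        ((twirlCoeff Λ (pauliSupport a) / fHat ω (pauliSupport a) - 1 : ℝ) : ℂ) *
          ((pauliString a * ρ).trace * (O * pauliString a).trace) := by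
  rw [trace_mul_eq_sum_pauli O ρ, lbraket, hO.eq]
  have h : invEstimate ω (noisyTwirl Λ ρ) = invEstimate ω (noisyTwirl Λ (((2 : ℂ) ^ n)⁻¹ •
      ∑ a : Fin n → Fin 2 × Fin 2, (pauliString a * ρ).trace • pauliString a)) := by
    rw [← pauli_expansion ρ]
  rw [h]
  simp only [map_smul, map_sum, noisyTwirl_pauliString hΛ, invEstimate_pauliString,
    Matrix.mul_smul, Finset.mul_sum, Matrix.trace_smul, Matrix.trace_sum, smul_eq_mul]
  rw [← Finset.sum_sub_distrib]
  refine Finset.sum_congr rfl fun a _ => ?_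
  push_cast
  ring

theorem card_supported {n : ℕ} (S : Finset (Fin n)) :
    (Finset.univ.filter fun a : Fin n → Fin 2 × Fin 2 => ∀ i, i ∉ S → a i = (0, 0)).card =
      4 ^ S.card := by
  have h : (Finset.univ.filter fun a : Fin n → Fin 2 × Fin 2 => ∀ i, i ∉ S → a i = (0, 0)) =
      Fintype.piFinset fun i => if i ∈ S then Finset.univ else {(0, 0)} := by
    ext a
    simp only [Finset.mem_filter, Finset.mem_univ, true_and, Fintype.mem_piFinset]
    refine forall_congr' fun i => ?_
    by_cases hi : i ∈ S <;> simp [hi]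
  rw [h, Fintype.card_piFinset]
  have e : ∀ i, (if i ∈ S then (Finset.univ : Finset (Fin 2 × Fin 2)) else {(0, 0)}).card =
      if i ∈ S then 4 else 1 := by
    intro i; split_ifs <;> simp
  simp [e]

theorem norm_error_le {n N K k : ℕ} {Λ : SuperOp n} (hΛ : IsQuantumChannel Λ) (ω : Record n N K)
    {ε : ℝ} (hε : 0 ≤ ε)
    (h : ∀ z : Bits n, weight z ≤ k → |twirlCoeff Λ z / fHat ω z - 1| ≤ ε)
    {O : Op n} (hO : O.IsHermitian) (hk : IsLocal k O) {ρ : Op n} (hρ : IsState ρ) :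
    ‖lbraket O (invEstimate ω (noisyTwirl Λ ρ)) - (O * ρ).trace‖ ≤ ε * 2 ^ k * opNorm O := by
  obtain ⟨S, hS, T, hT⟩ := hk
  set A := Finset.univ.filter fun a : Fin n → Fin 2 × Fin 2 => ∀ i, i ∉ S → a i = (0, 0) with hA
  have hzero : ∀ a ∉ A, (O * pauliString a).trace = 0 := by
    intro a ha
    simp only [hA, Finset.mem_filter, Finset.mem_univ, true_and, not_forall] at ha
    obtain ⟨j, hj, haj⟩ := ha
    exact trace_mul_pauliString_eq_zero hT hj haj
  have hweight : ∀ a ∈ A, weight (pauliSupport a) ≤ k := by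
    intro a ha
    rw [← hS, weight]
    refine Finset.card_le_card fun i hi => ?_
    by_contra hiS
    have := (Finset.mem_filter.1 ha).2 i hiS
    simp [pauliSupport, this] at hi
  have hnorm : 0 ≤ opNorm O := norm_nonneg _
  -- Cauchy–Schwarz over the `4^k` Paulis supported in `S`, then Parseval. The factor `2^n` cancels
  -- the normalization of the expansion.
  have hcs : ∑ a ∈ A, ‖(O * pauliString a).trace‖ ≤ 2 ^ k * (2 ^ n * opNorm O) := by
    refine le_of_sq_le_sq ?_ (by positivity)
    calc _ ≤ (A.card : ℝ) * ∑ a ∈ A, ‖(O * pauliString a).trace‖ ^ 2 :=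
          sq_sum_le_card_mul_sum_sq
      _ ≤ 4 ^ k * (2 ^ n * (2 ^ n * opNorm O ^ 2)) := by
          rw [hA, card_supported, hS]
          push_cast
          refine mul_le_mul_of_nonneg_left ?_ (by positivity)
          refine le_trans (Finset.sum_le_univ_sum_of_nonneg fun a => by positivity) ?_
          rw [sum_normSq_trace_pauliString]
          exact mul_le_mul_of_nonneg_left (trace_conjTranspose_mul_le O) (by positivity)
      _ = _ := by
          rw [show (4 : ℝ) = 2 ^ 2 by norm_num, ← pow_mul]
          ring
  rw [error_eq_sum hΛ ω hO, norm_mul, norm_inv, norm_pow, Complex.norm_ofNat,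
    inv_mul_le_iff₀ (by positivity), ← Finset.sum_subset (Finset.subset_univ A)
      (fun a _ ha => by rw [hzero a ha]; ring)]
  calc _ ≤ ∑ a ∈ A, ε * ‖(O * pauliString a).trace‖ := by
        refine norm_sum_le_of_le _ fun a ha => ?_
        rw [norm_mul, norm_mul, Complex.norm_real, Real.norm_eq_abs]
        refine mul_le_mul (h _ (hweight a ha)) ?_ (by positivity) hε
        exact mul_le_of_le_one_left (norm_nonneg _) (norm_trace_pauliString_mul_le hρ a)
    _ ≤ ε * (2 ^ k * (2 ^ n * opNorm O)) := by
        rw [← Finset.mul_sum]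
        exact mul_le_mul_of_nonneg_left hcs hε
    _ = _ := by ring

theorem card_weight_le (n k : ℕ) :
    (Finset.univ.filter fun z : Bits n => weight z ≤ k).card ≤ (n + 1) ^ k := by
  classical
  have hsub : (Finset.univ.filter fun z : Bits n => weight z ≤ k) ⊆
      (Finset.univ : Finset (Fin k → Option (Fin n))).image
        fun f i => if ∃ j, f j = some i then 1 else 0 := by
    intro z hz
    have hz := (Finset.mem_filter.1 hz).2
    rw [Finset.mem_image]
    -- A support of size at most `k` is coded by a list of its positions, padded with `none` to
    -- length `k`.
    refine ⟨fun j => (Finset.univ.filter fun i => z i = 1).toList[j.val]?, Finset.mem_univ _, ?_⟩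
    funext i
    have hmem : (∃ j : Fin k, (Finset.univ.filter fun i => z i = 1).toList[j.val]? = some i) ↔
        z i = 1 := by
      have h1 : i ∈ (Finset.univ.filter fun i => z i = 1).toList ↔ z i = 1 := by simp
      rw [← h1, List.mem_iff_getElem?]
      constructor
      · rintro ⟨j, hj⟩; exact ⟨j, hj⟩
      · rintro ⟨j, hj⟩
        refine ⟨⟨j, ?_⟩, hj⟩
        have := (List.getElem?_eq_some_iff.1 hj).1
        rw [Finset.length_toList] at this
        exact this.trans_le hz
    simp only [hmem]
    generalize z i = t
    fin_cases t <;> simp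
  refine (Finset.card_le_card hsub).trans (Finset.card_image_le.trans ?_)
  simp

/-! ### Sample complexity -/

theorem minGamSq_le {n : ℕ} (Λ : SuperOp n) {k : ℕ} {z : Bits n} (hz : weight z ≤ k) :
    minGamSq Λ k ≤ Gam Λ z ^ 2 :=
  Finset.inf'_le (fun z => Gam Λ z ^ 2) (Finset.mem_filter.2 ⟨Finset.mem_univ _, hz⟩)

theorem minGamSq_le_one {n : ℕ} {Λ : SuperOp n} (hΛ : IsQuantumChannel Λ) (k : ℕ) :
    minGamSq Λ k ≤ 1 := by
  have := minGamSq_le Λ (k := k) (z := 0) (by simp [weight])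
  rwa [Gam_zero hΛ, one_pow] at this

/-- The cap `min ε 1` keeps `|f̂_z| ≥ |f_z| / 2 > 0`. Passing from error relative to `f_z` to error
relative to `f̂_z` thus costs a factor `2`, which the `1/2` in the hypothesis absorbs. -/
theorem mem_successEvent {n N K k : ℕ} {Λ : SuperOp n} (hΛ : IsQuantumChannel Λ) {ε : ℝ}
    (hε : 0 < ε) (hμ : 0 < minGamSq Λ k) {ω : Record n N K}
    (h : ∀ z : Bits n, weight z ≤ k →
      |fHat ω z - twirlCoeff Λ z| ≤ min ε 1 / 2 * |twirlCoeff Λ z|) :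
    ω ∈ successEvent Λ k ε N K := by
  have hm : 0 < min ε 1 := lt_min hε one_pos
  have hm1 : min ε 1 ≤ 1 := min_le_right _ _
  have hf : ∀ z : Bits n, weight z ≤ k → 0 < |twirlCoeff Λ z| := by
    intro z hz
    rw [abs_pos, twirlCoeff]
    have : Gam Λ z ≠ 0 := by
      intro h0
      have := minGamSq_le Λ hz
      rw [h0] at this
      norm_num at this
      linarith
    positivity
  have hlow : ∀ z : Bits n, weight z ≤ k → |twirlCoeff Λ z| / 2 ≤ |fHat ω z| := by
    intro z hz
    have h1 := abs_sub_abs_le_abs_sub (twirlCoeff Λ z) (fHat ω z)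
    rw [abs_sub_comm] at h1
    have h2 := h z hz
    nlinarith [hf z hz]
  have hne : ∀ z : Bits n, weight z ≤ k → fHat ω z ≠ 0 := by
    intro z hz h0
    have h1 := hlow z hz
    rw [h0, abs_zero] at h1
    linarith [hf z hz]
  refine ⟨hne, fun O hO hk ρ hρ => norm_error_le hΛ ω hε.le (fun z hz => ?_) hO hk hρ⟩
  have hpos := abs_pos.2 (hne z hz)
  rw [div_sub_one (hne z hz), abs_div, div_le_iff₀ hpos, abs_sub_comm]
  calc _ ≤ min ε 1 / 2 * |twirlCoeff Λ z| := h z hz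
    _ ≤ min ε 1 * |fHat ω z| := by nlinarith [hlow z hz]
    _ ≤ ε * |fHat ω z| := by gcongr; exact min_le_left _ _

theorem calibrationLaw_successEvent {n N K k : ℕ} {Λ : SuperOp n} (hΛ : IsQuantumChannel Λ)
    {ε δ : ℝ} (hε : 0 < ε) (hμ : 0 < minGamSq Λ k)
    (hN : 64 * 3 ^ k / ((min ε 1) ^ 2 * minGamSq Λ k) ≤ N)
    (hK : ((n : ℝ) + 1) ^ k * (1 / 2) ^ K ≤ δ) :
    ENNReal.ofReal (1 - δ) ≤ calibrationLaw Λ N K (successEvent Λ k ε N K) := by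
  have hm : 0 < min ε 1 := lt_min hε one_pos
  have hN0 : (0 : ℝ) < N := lt_of_lt_of_le (by positivity) hN
  have := isProbabilityMeasure_roundLaw hΛ
  have hprob : MeasureTheory.IsProbabilityMeasure (calibrationLaw Λ N K) := by
    rw [calibrationLaw]; infer_instance
  have hδ : 0 ≤ δ := le_trans (by positivity) hK
  set Z := Finset.univ.filter fun z : Bits n => weight z ≤ k with hZ
  set F : Bits n → Set (Record n N K) := fun z =>
    {ω | min ε 1 / 2 * |twirlCoeff Λ z| < |fHat ω z - twirlCoeff Λ z|} with hF
  have hFz : ∀ z ∈ Z, calibrationLaw Λ N K (F z) ≤ ENNReal.ofReal ((1 / 2) ^ K) := by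
    intro z hz
    have hz := (Finset.mem_filter.1 hz).2
    have hG2 := minGamSq_le Λ hz
    have hG : Gam Λ z ≠ 0 := by
      intro h0
      rw [h0] at hG2
      norm_num at hG2
      linarith
    refine measure_fHat_deviation_le hΛ z ?_ (by exact_mod_cast hN0) K ?_
    · have : 0 < |twirlCoeff Λ z| := by
        rw [abs_pos, twirlCoeff]; positivity
      positivity
    · rw [div_le_iff₀ (by positivity)] at hN
      have h3 : (3 : ℝ) ^ weight z ≤ 3 ^ k := pow_le_pow_right₀ (by norm_num) hz
      have h1 : 64 * (3 : ℝ) ^ weight z ≤ N * ((min ε 1) ^ 2 * Gam Λ z ^ 2) :=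
        calc _ ≤ 64 * (3 : ℝ) ^ k := by gcongr
          _ ≤ _ := hN
          _ ≤ _ := by gcongr
      -- The squared tolerance carries `9^{-|z|}` against the second moment `3^{-|z|}`, leaving
      -- `3^{|z|}`. The `64` is `4 · 16`: `4` from halving the tolerance, `16` from the target
      -- failure probability `1/16`.
      have h2 : (3⁻¹ : ℝ) ^ weight z / (N * (min ε 1 / 2 * |twirlCoeff Λ z|) ^ 2) =
          4 * 3 ^ weight z / (N * ((min ε 1) ^ 2 * Gam Λ z ^ 2)) := by
        rw [mul_pow, sq_abs, twirlCoeff, inv_pow]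
        field_simp
        norm_num
      rw [h2, div_le_iff₀ (by positivity)]
      linarith
  have hcompl : calibrationLaw Λ N K (successEvent Λ k ε N K)ᶜ ≤ ENNReal.ofReal δ := by
    calc _ ≤ calibrationLaw Λ N K (⋃ z ∈ Z, F z) := by
          refine MeasureTheory.measure_mono fun ω hω => ?_
          by_contra hc
          refine hω (mem_successEvent hΛ hε hμ fun z hz => ?_)
          by_contra hcz
          exact hc (Set.mem_biUnion (Finset.mem_filter.2 ⟨Finset.mem_univ _, hz⟩)
            (not_le.1 hcz))
      _ ≤ ∑ z ∈ Z, calibrationLaw Λ N K (F z) := MeasureTheory.measure_biUnion_finset_le _ _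
      _ ≤ ∑ z ∈ Z, ENNReal.ofReal ((1 / 2) ^ K) := Finset.sum_le_sum hFz
      _ = ENNReal.ofReal (Z.card * (1 / 2) ^ K) := by
          rw [Finset.sum_const, nsmul_eq_mul, ENNReal.ofReal_mul (by positivity),
            ENNReal.ofReal_natCast]
      _ ≤ ENNReal.ofReal δ := by
          refine ENNReal.ofReal_le_ofReal (le_trans ?_ hK)
          gcongr
          exact_mod_cast card_weight_le n k
  have hmeas : MeasurableSet (successEvent Λ k ε N K) := (Set.toFinite _).measurableSet
  rw [MeasureTheory.prob_compl_eq_one_sub hmeas, tsub_le_iff_left] at hcompl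
  rw [ENNReal.ofReal_sub _ hδ, ENNReal.ofReal_one, tsub_le_iff_left]
  rwa [add_comm] at hcompl

/-- The number of rounds per group. -/
def groupSize (k : ℕ) (ε μ : ℝ) : ℕ := ⌈64 * 3 ^ k / ((min ε 1) ^ 2 * μ)⌉₊

/-- The number of groups. -/
def groupCount (n k : ℕ) (δ : ℝ) : ℕ := ⌈(2 * k * Real.log n + Real.log δ⁻¹) / Real.log 2⌉₊

/-- Keeps the logarithmic factor away from `0`, so that rounding `groupCount` up costs only a
constant. This is where `k = 0` needs `δ ≤ 1/2`. -/
theorem log_two_le {n k : ℕ} {δ : ℝ} (hn : 2 ≤ n) (h0 : 0 < δ) (h1 : δ < 1)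
    (hk : 1 ≤ k ∨ δ ≤ 1 / 2) : Real.log 2 ≤ k * Real.log n + Real.log δ⁻¹ := by
  have hn' : (2 : ℝ) ≤ n := by exact_mod_cast hn
  have hlog : Real.log 2 ≤ Real.log n := Real.log_le_log two_pos hn'
  have hl2 := Real.log_pos one_lt_two
  have hδ : 0 ≤ Real.log δ⁻¹ := Real.log_nonneg ((one_le_inv₀ h0).2 h1.le)
  rcases hk with hk | hk
  · have : (1 : ℝ) ≤ k := by exact_mod_cast hk
    nlinarith
  · have : Real.log 2 ≤ Real.log δ⁻¹ := by
      refine Real.log_le_log two_pos ?_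
      rw [le_inv_comm₀ two_pos h0]
      linarith
    have : 0 ≤ (k : ℝ) * Real.log n := by positivity
    linarith

/-- `390 = 65 · 6`. The first ceiling adds at most `1 ≤ 3^k / (min(ε,1)² μ)` to `64` times that
quantity. With `L = k log n + log δ⁻¹ ≥ log 2`, the second is at most `2L / log 2 + 1 ≤ 3L / log 2 ≤
6L`. -/
theorem groupSize_mul_groupCount_le {n k : ℕ} {ε δ μ : ℝ} (hn : 2 ≤ n) (hε : 0 < ε)
    (h0 : 0 < δ) (h1 : δ < 1) (hk : 1 ≤ k ∨ δ ≤ 1 / 2) (hμ : 0 < μ) (hμ1 : μ ≤ 1) :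
    ((groupSize k ε μ * groupCount n k δ : ℕ) : ℝ) ≤
      390 * (3 ^ k * (k * Real.log n + Real.log δ⁻¹) / ((min ε 1) ^ 2 * μ)) := by
  have hm : 0 < min ε 1 := lt_min hε one_pos
  have hL := log_two_le hn h0 h1 hk
  have hl2 : 1 / 2 < Real.log 2 := by linarith [Real.log_two_gt_d9]
  have hδ : 0 ≤ Real.log δ⁻¹ := Real.log_nonneg ((one_le_inv₀ h0).2 h1.le)
  have hkn : 0 ≤ (k : ℝ) * Real.log n := by positivity
  have hA : (1 : ℝ) ≤ 3 ^ k / ((min ε 1) ^ 2 * μ) := by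
    rw [one_le_div (by positivity)]
    calc (min ε 1) ^ 2 * μ ≤ 1 * 1 := by
          gcongr
          exact pow_le_one₀ hm.le (min_le_right _ _)
      _ ≤ 3 ^ k := by rw [one_mul]; exact one_le_pow₀ (by norm_num)
  have hN : (groupSize k ε μ : ℝ) ≤ 65 * (3 ^ k / ((min ε 1) ^ 2 * μ)) := by
    have := (Nat.ceil_lt_add_one (a := 64 * 3 ^ k / ((min ε 1) ^ 2 * μ)) (by positivity)).le
    rw [groupSize]
    rw [mul_div_assoc] at this ⊢
    linarith
  have hK : (groupCount n k δ : ℝ) ≤ 6 * (k * Real.log n + Real.log δ⁻¹) := by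
    have h2 : 0 ≤ (2 * k * Real.log n + Real.log δ⁻¹) / Real.log 2 :=
      div_nonneg (by nlinarith) (by linarith)
    have h3 := (Nat.ceil_lt_add_one h2).le
    rw [groupCount]
    refine h3.trans ?_
    rw [div_add_one (by linarith), div_le_iff₀ (by linarith)]
    nlinarith
  push_cast
  calc _ ≤ 65 * (3 ^ k / ((min ε 1) ^ 2 * μ)) * (6 * (k * Real.log n + Real.log δ⁻¹)) := by
        gcongr
    _ = _ := by ring

/-- For `n ≥ 2` one has `n + 1 ≤ n²`, hence `(n+1)^k ≤ n^{2k}`; this explains the factor `2` in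
`groupCount`. -/
theorem union_bound_le {n k K : ℕ} {δ : ℝ} (hn : 2 ≤ n) (h0 : 0 < δ)
    (hK : groupCount n k δ ≤ K) : ((n : ℝ) + 1) ^ k * (1 / 2) ^ K ≤ δ := by
  have hn' : (2 : ℝ) ≤ n := by exact_mod_cast hn
  have hl2 := Real.log_pos one_lt_two
  have h1 : (2 * k * Real.log n + Real.log δ⁻¹) / Real.log 2 ≤ K :=
    (Nat.le_ceil _).trans (Nat.cast_le.2 hK)
  rw [div_le_iff₀ hl2] at h1
  have h2 : Real.log ((n : ℝ) ^ (2 * k) * δ⁻¹) ≤ Real.log (2 ^ K) := by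
    rw [Real.log_mul (by positivity) (by positivity), Real.log_pow, Real.log_pow]
    push_cast
    exact h1
  rw [Real.log_le_log_iff (by positivity) (by positivity), ← div_eq_mul_inv,
    div_le_iff₀ h0] at h2
  rw [one_div, inv_pow, ← div_eq_mul_inv, div_le_iff₀ (by positivity), mul_comm δ]
  refine le_trans ?_ h2
  rw [pow_mul]
  gcongr
  nlinarith

theorem calibrationSuffices {n k : ℕ} {ε δ : ℝ} {Λ : SuperOp n} (hn : 2 ≤ n) (hε : 0 < ε)
    (h0 : 0 < δ) (h1 : δ < 1) (hk : 1 ≤ k ∨ δ ≤ 1 / 2) (hΛ : IsQuantumChannel Λ)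
    (hμ : 0 < minGamSq Λ k) :
    CalibrationSuffices Λ k ε δ (groupSize k ε (minGamSq Λ k)) (groupCount n k δ) := by
  have hm : 0 < min ε 1 := lt_min hε one_pos
  refine ⟨Nat.ceil_pos.2 (by positivity), Nat.ceil_pos.2 ?_, fun N K hN hK =>
    calibrationLaw_successEvent hΛ hε hμ ((Nat.le_ceil _).trans (Nat.cast_le.2 hN))
      (union_bound_le hn h0 hK)⟩
  have hL := log_two_le hn h0 h1 hk
  have hl2 := Real.log_pos one_lt_two
  have : 0 ≤ (k : ℝ) * Real.log n := by positivity
  exact div_pos (by linarith) hl2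

theorem one_sub_two_mul_sq_le_minGamSq {n k : ℕ} {Λ : SuperOp n} (hΛ : IsQuantumChannel Λ)
    {c : ℝ} (hc : c < 1 / 2) (h : 1 - c ≤ fidelityZ Λ) : (1 - 2 * c) ^ 2 ≤ minGamSq Λ k := by
  refine Finset.le_inf' _ _ fun z _ => pow_le_pow_left₀ (by linarith) ?_ 2
  linarith [two_mul_fidelityZ_sub_one_le_Gam hΛ z]

end

end RShadow

/-! ### Assembly of the three claims. -/

theorem mainTheorem4 :
    ∃ (C : ℝ) (N₀ : ℕ → ℝ → ℝ → ℕ) (K₀ : ℕ → ℕ → ℝ → ℕ), 0 < C ∧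
      ∀ (n k : ℕ) (ε δ : ℝ) (Λ : RShadow.SuperOp n),
        2 ≤ n → k ≤ n → 0 < ε → 0 < δ → δ < 1 → (1 ≤ k ∨ δ ≤ 1 / 2) →
        RShadow.IsQuantumChannel Λ →
        (0 < RShadow.minGamSq Λ k →
          ((N₀ k ε (RShadow.minGamSq Λ k) * K₀ n k δ : ℕ) : ℝ) ≤
              C * (3 ^ k * (k * Real.log n + Real.log δ⁻¹) /
                ((min ε 1) ^ 2 * RShadow.minGamSq Λ k)) ∧
            RShadow.CalibrationSuffices Λ k ε δ (N₀ k ε (RShadow.minGamSq Λ k)) (K₀ n k δ)) ∧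
        (∀ c : ℝ, 0 ≤ c → c ≤ 1 → 1 - c ≤ RShadow.fidelityZ Λ →
          ∀ z : RShadow.Bits n, 1 - 2 * c ≤ RShadow.Gam Λ z) ∧
        (∀ c : ℝ, 0 ≤ c → c < 1 / 2 → 1 - c ≤ RShadow.fidelityZ Λ →
          0 < RShadow.minGamSq Λ k ∧
          ((N₀ k ε (RShadow.minGamSq Λ k) * K₀ n k δ : ℕ) : ℝ) ≤
              C / (1 - 2 * c) ^ 2 * (3 ^ k * (k * Real.log n + Real.log δ⁻¹) /
                ((min ε 1) ^ 2 * RShadow.fidelityZ Λ ^ 2)) ∧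
            RShadow.CalibrationSuffices Λ k ε δ (N₀ k ε (RShadow.minGamSq Λ k)) (K₀ n k δ)) := by
  refine ⟨390, RShadow.groupSize, RShadow.groupCount, by norm_num, ?_⟩
  intro n k ε δ Λ hn _ hε h0 h1 hk hΛ
  refine ⟨fun hμ => ⟨RShadow.groupSize_mul_groupCount_le hn hε h0 h1 hk hμ
      (RShadow.minGamSq_le_one hΛ k), RShadow.calibrationSuffices hn hε h0 h1 hk hΛ hμ⟩,
    fun c _ _ hF z => by linarith [RShadow.two_mul_fidelityZ_sub_one_le_Gam hΛ z],
    fun c hc0 hc hF => ?_⟩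
  have hc' : 0 < 1 - 2 * c := by linarith
  have hle := RShadow.one_sub_two_mul_sq_le_minGamSq (k := k) hΛ hc hF
  have hμ : 0 < RShadow.minGamSq Λ k := lt_of_lt_of_le (by positivity) hle
  refine ⟨hμ, ?_, RShadow.calibrationSuffices hn hε h0 h1 hk hΛ hμ⟩
  refine (RShadow.groupSize_mul_groupCount_le hn hε h0 h1 hk hμ
    (RShadow.minGamSq_le_one hΛ k)).trans ?_
  have hL := RShadow.log_two_le hn h0 h1 hk
  have hl2 := Real.log_pos one_lt_two
  have hm : 0 < min ε 1 := lt_min hε one_pos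
  have hF0 : 0 < RShadow.fidelityZ Λ := by linarith
  -- Since `F_Z² ≤ 1`, putting it in the denominator only weakens the bound; the decay of `μ` is
  -- controlled by `(1 - 2c)²` alone.
  have hF1 : RShadow.fidelityZ Λ ^ 2 ≤ 1 := pow_le_one₀ hF0.le (RShadow.fidelityZ_le_one hΛ)
  rw [div_mul_div_comm, ← mul_div_assoc]
  have hnum : 0 ≤ 390 * (3 ^ k * (k * Real.log n + Real.log δ⁻¹)) :=
    mul_nonneg (by norm_num) (mul_nonneg (by positivity) (by linarith))
  refine div_le_div_of_nonneg_left hnum (by positivity) ?_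
  calc (1 - 2 * c) ^ 2 * ((min ε 1) ^ 2 * RShadow.fidelityZ Λ ^ 2)
      ≤ RShadow.minGamSq Λ k * ((min ε 1) ^ 2 * 1) := by gcongr
    _ = _ := by ring
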